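/- Let $\rho\in(0,1)$, $\gamma\in(0,1)$, $\alpha_1,\alpha_2>0$, and let $$F_{CES}(l_1,l_2)=\bigl(\alpha_1 l_1^{-\rho}+\alpha_2 l_2^{-\rho}\bigr)^{-\gamma/\rho}\quad(l_1,l_2>0),$$ extended by continuity by $0$ to the points $l\ge 0$ with $l_1l_2=0$, be the CES production function. The generalized Houthakker-Johansen model is given by a nonnegative Borel measure $\mu$ on $\mathbb R^n_+$ (the distribution of capacities over technologies) and a nonnegative, concave, continuous function $f$ on $\mathbb R^n_+$ that is positively homogeneous of degree one (the micro-level production function). Its production function assigns to each $l\ge 0$ the maximum of $$\int_{\mathbb R^n_+}\min\Bigl(1,f\bigl(\tfrac{u_1(x)}{x_1},\dots,\tfrac{u_n(x)}{x_n}\bigr)\Bigr)\,\mu(dx)$$ over all $u=(u_1,\dots,u_n)\ge 0$ with $\mu$-integrable components and $\int u_j\,d\mu\le l_j$, $j=1,\dots,n$. For $p,x\ge 0$, write $p\circ x=(p_1x_1,\dots,p_nx_n)$; the unit cost of technology $x$ at prices $p$ is $h(p\circ x)$, where $h(p)=\inf\{p\cdot v/f(v): v\ge 0,\ f(v)>0\}$.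 Then $F_{CES}$ is the production function of the generalized model ($n=2$) with unit cost $$h(p\circ x)=\bigl((p_1x_1)^{\frac{2\rho}{1+\rho}}+(p_2x_2)^{\frac{2\rho}{1+\rho}}\bigr)^{\frac{1+\rho}{2\rho}}$$ and distribution of capacities $$\mu(dx)=B_\rho\,(x_1x_2)^{-\frac{\rho}{1+\rho}-1}\Bigl(\alpha_1^{\frac2{1+\rho}}x_1^{-\frac{2\rho}{1+\rho}}+\alpha_2^{\frac2{1+\rho}}x_2^{-\frac{2\rho}{1+\rho}}\Bigr)^{-\frac{\gamma}{1-\gamma}\frac{1+\rho}{2\rho}-1}dx,\qquad x_1,x_2>0,$$ $$B_\rho=\frac{2\rho}{1+\rho}\,\frac{\gamma^{\frac1{1-\gamma}}}{1-\gamma}\,\frac{2^{b-2}}{\pi}(\alpha_1\alpha_2)^{\frac1{1+\rho}}\,b\,B\bigl(\tfrac b2,\tfrac b2\bigr),\qquad b=\frac{\gamma}{1-\gamma}\,\frac{1+\rho}{\rho},$$ where $B(\cdot,\cdot)$ is the beta function. That is, there is such a function $f$ with this $h$, and for every such $f$ with this $h$ the maximum above exists and equals $F_{CES}(l)$ for every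 $l\ge 0$. -/

import Mathlib

open MeasureTheory
open scoped ENNReal

namespace ResourceModel

/-- Micro-level production function `f` on the closed orthant: positively homogeneous of degree
one, concave, continuous, nonnegative. -/
structure IsMicroFunction {n : ℕ} (f : (Fin n → ℝ) → ℝ) : Prop where
  nonneg : ∀ v, 0 ≤ v → 0 ≤ f v
  homogeneous : ∀ t : ℝ, 0 < t → ∀ v, 0 ≤ v → f (t • v) = t * f v
  concave : ConcaveOn ℝ (Set.Ici 0) f
  continuousOn : ContinuousOn f (Set.Ici 0)

/-- The Young transform `h(p) = inf {(p ⬝ v) / f(v) : v ≥ 0, f(v) > 0}`. The unit cost of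
technology `x` at prices `p` is `youngTransform f (p * x)` (coordinatewise product). -/
noncomputable def youngTransform {n : ℕ} (f : (Fin n → ℝ) → ℝ) (p : Fin n → ℝ) : ℝ :=
  sInf {c | ∃ v : Fin n → ℝ, 0 ≤ v ∧ 0 < f v ∧ c = (∑ j, p j * v j) / f v}

/-- Admissible input plans `u` for the distribution of capacities `μ` and the resources `l`:
nonnegative, with integrable components, using at most `l j` of the resource `j`. -/
structure IsAdmissible {n : ℕ} (μ : Measure (Fin n → ℝ)) (l : Fin n → ℝ)
    (u : (Fin n → ℝ) → Fin n → ℝ) : Prop where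
  nonneg : ∀ᵐ x ∂μ, 0 ≤ u x
  integrable : ∀ j, Integrable (fun x => u x j) μ
  integral_le : ∀ j, ∫ x, u x j ∂μ ≤ l j

/-- Total output `∫ min(1, f(u₁(x)/x₁, …, uₙ(x)/xₙ)) μ(dx)` of the plan `u`, for `f` nonnegative
and `μ` carried by the open orthant; the integral of this nonnegative function may be infinite. -/
noncomputable def totalOutput {n : ℕ} (f : (Fin n → ℝ) → ℝ) (μ : Measure (Fin n → ℝ))
    (u : (Fin n → ℝ) → Fin n → ℝ) : ℝ≥0∞ :=
  ∫⁻ x, ENNReal.ofReal (min 1 (f (fun j => u x j / x j))) ∂μ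

/-- `F` is the production function of the resource distribution problem given by `f` and `μ`:
for every `l ≥ 0` the value `F l` is the maximum of the total output over all admissible plans. -/
def IsProductionFunction {n : ℕ} (f : (Fin n → ℝ) → ℝ) (μ : Measure (Fin n → ℝ))
    (F : (Fin n → ℝ) → ℝ≥0∞) : Prop :=
  ∀ l : Fin n → ℝ, 0 ≤ l →
    IsGreatest {y | ∃ u, IsAdmissible μ l u ∧ y = totalOutput f μ u} (F l)

/-- The CES production function `(α₁ l₁ ^ (-ρ) + α₂ l₂ ^ (-ρ)) ^ (-γ / ρ)` for `ρ > 0`, extended by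
continuity by the value `0` to the `l` with a vanishing coordinate. -/
noncomputable def cesProduction (α₁ α₂ ρ γ : ℝ) (l : Fin 2 → ℝ) : ℝ :=
  if 0 < l 0 ∧ 0 < l 1 then (α₁ * l 0 ^ (-ρ) + α₂ * l 1 ^ (-ρ)) ^ (-γ / ρ) else 0

/-- The CES unit cost function `(p₁ ^ s + p₂ ^ s) ^ (1 / s)`. -/
noncomputable def cesUnitCost (s : ℝ) (p : Fin 2 → ℝ) : ℝ :=
  (p 0 ^ s + p 1 ^ s) ^ (1 / s)

/-- The exponent `b = γ / (1 - γ) * (1 + ρ) / ρ`. -/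
noncomputable def expB (ρ γ : ℝ) : ℝ := γ / (1 - γ) * ((1 + ρ) / ρ)

/-- The constant in front of the density of capacities; `ProbabilityTheory.beta` is Euler's beta
function. -/
noncomputable def capacityConst (α₁ α₂ ρ γ : ℝ) : ℝ :=
  2 * ρ / (1 + ρ) * (γ ^ (1 / (1 - γ)) / (1 - γ)) * (2 ^ (expB ρ γ - 2) / Real.pi) *
    (α₁ * α₂) ^ (1 / (1 + ρ)) * expB ρ γ *
      ProbabilityTheory.beta (expB ρ γ / 2) (expB ρ γ / 2)

/-- The density of capacities on the open quadrant. -/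
noncomputable def capacityDensity (α₁ α₂ ρ γ : ℝ) (x : Fin 2 → ℝ) : ℝ :=
  capacityConst α₁ α₂ ρ γ * (x 0 * x 1) ^ (-(ρ / (1 + ρ)) - 1) *
    (α₁ ^ (2 / (1 + ρ)) * x 0 ^ (-(2 * ρ / (1 + ρ))) +
      α₂ ^ (2 / (1 + ρ)) * x 1 ^ (-(2 * ρ / (1 + ρ)))) ^
        (-(γ / (1 - γ) * ((1 + ρ) / (2 * ρ))) - 1)

/-- The distribution of capacities: the measure on the open quadrant with the above density. -/
noncomputable def capacityMeasure (α₁ α₂ ρ γ : ℝ) : Measure (Fin 2 → ℝ) :=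
  (volume.restrict {x : Fin 2 → ℝ | ∀ j, 0 < x j}).withDensity
    fun x => ENNReal.ofReal (capacityDensity α₁ α₂ ρ γ x)

end ResourceModel

/-! ### Changes of variables and beta integrals on the half-line. -/

namespace ResourceModel

open Set

/-! The proof is convex duality between output and prices. Write `h` for the unit cost and Π(p) = ∫
(1 - h(p∘x))₊ dμ for the profit at prices p > 0. Since h(p∘x) f(u/x) ≤ p·u, every admissible plan
yields at most Π(p) + p·l (`totalOutput_le`). Equality holds for `optimalPlan`: technologies with
h(p∘x) ≤ 1 run at full capacity on the inputs x∘∇h(p∘x). If U is the total input of this plan, weak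
duality at all other prices shows that p minimizes Π(p') + p'·U, so U = -∇Π(p). Hence if -∇Π(p) = l,
the plan uses exactly l and Π(p) + p·l is the maximum (`isGreatest_totalOutput`). No convexity or
differentiability of Π beyond its partial derivatives at p is needed.

Two inputs about f enter: the infimum defining h is attained at positive prices, and comparing the
linear cost of the minimizer with h identifies it as ∇h, so f(∇h) = 1 (`apply_cesCostGrad`). This
works for every f with the given h. One such f is the concave dual `cesMicro`; here ρ < 1 is used,
through s = 2ρ/(1+ρ) < 1.

It remains to compute Π (`lintegral_profit`). In the coordinates x and t = y/x the density is a
power of x times a function of t. The radial integral is a beta integral; the angular one reduces,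
by symmetrization and the substitution w = nz - m/z, to ∫ (1+v²)^(-b/2-1) dv, and B_ρ is chosen to
cancel the resulting constant. The outcome is `cesProfit`, the conjugate of the CES function: at p =
∇F(l) one has -∇Π(p) = l (`hasDerivAt_cesProfit`) and Π(p) + p·l = F(l) (`cesProfit_add_cost`). If
some l_j = 0, nothing can be produced and the value is 0. -/

lemma lintegral_Ioi_comp_mul_left (g : ℝ → ℝ≥0∞) {c : ℝ} (hc : 0 < c) :
    ∫⁻ x in Ioi 0, g x = ∫⁻ z in Ioi 0, ENNReal.ofReal c * g (c * z) := by
  have himg : (fun z => c * z) '' Ioi (0 : ℝ) = Ioi 0 := by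
    ext x
    simp only [mem_image, mem_Ioi]
    exact ⟨by rintro ⟨z, hz, rfl⟩; positivity, fun hx => ⟨x / c, by positivity, by field_simp⟩⟩
  rw [← himg, lintegral_image_eq_lintegral_abs_deriv_mul (f' := fun _ => c) measurableSet_Ioi
    (fun x _ => by simpa using ((hasDerivAt_id x).const_mul c).hasDerivWithinAt)
    (mul_right_injective₀ hc.ne').injOn, abs_of_pos hc, himg]

lemma lintegral_Ioi_comp_rpow (g : ℝ → ℝ≥0∞) {k : ℝ} (hk : 0 < k) :
    ∫⁻ x in Ioi 0, g x = ∫⁻ z in Ioi 0, ENNReal.ofReal (k * z ^ (k - 1)) * g (z ^ k) := by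
  have himg : (fun z : ℝ => z ^ k) '' Ioi (0 : ℝ) = Ioi 0 := by
    ext x
    simp only [mem_image, mem_Ioi]
    exact ⟨by rintro ⟨z, hz, rfl⟩; positivity,
      fun hx => ⟨x ^ k⁻¹, by positivity, Real.rpow_inv_rpow hx.le hk.ne'⟩⟩
  conv_lhs => rw [← himg]
  rw [lintegral_image_eq_lintegral_abs_deriv_mul (f' := fun z => k * z ^ (k - 1))
    measurableSet_Ioi
    (fun x (hx : 0 < x) => (Real.hasDerivAt_rpow_const (Or.inl hx.ne')).hasDerivWithinAt)
    (fun x (hx : 0 < x) y (hy : 0 < y) h => Real.rpow_left_injOn hk.ne' hx.le hy.le h)]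
  refine setLIntegral_congr_fun measurableSet_Ioi fun x (hx : 0 < x) => ?_
  rw [abs_of_pos (by positivity)]

lemma lintegral_Ioi_comp_div (g : ℝ → ℝ≥0∞) {c : ℝ} (hc : 0 < c) :
    ∫⁻ x in Ioi 0, g x = ∫⁻ z in Ioi 0, ENNReal.ofReal (c / z ^ 2) * g (c / z) := by
  have himg : (fun z : ℝ => c / z) '' Ioi (0 : ℝ) = Ioi 0 := by
    ext x
    simp only [mem_image, mem_Ioi]
    exact ⟨by rintro ⟨z, hz, rfl⟩; positivity,
      fun hx => ⟨c / x, by positivity, by field_simp⟩⟩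
  conv_lhs => rw [← himg]
  rw [lintegral_image_eq_lintegral_abs_deriv_mul (f' := fun z => -(c / z ^ 2)) measurableSet_Ioi]
  · refine setLIntegral_congr_fun measurableSet_Ioi fun x (hx : 0 < x) => ?_
    rw [abs_neg, abs_of_pos (by positivity)]
  · intro x (hx : 0 < x)
    convert! ((hasDerivAt_inv hx.ne').const_mul c).hasDerivWithinAt using 1
    field_simp
  · intro x (hx : 0 < x) y (hy : 0 < y) h
    simp only at h
    field_simp at h
    exact h.symm

lemma lintegral_Ioo_rpow_mul_rpow {α β : ℝ} (hα : 0 < α) (hβ : 0 < β) :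
    ∫⁻ x in Ioo (0 : ℝ) 1, ENNReal.ofReal (x ^ (α - 1) * (1 - x) ^ (β - 1)) =
      ENNReal.ofReal (ProbabilityTheory.beta α β) := by
  have hb := ProbabilityTheory.beta_pos hα hβ
  have h := ProbabilityTheory.lintegral_betaPDF_eq_one hα hβ
  rw [ProbabilityTheory.lintegral_betaPDF] at h
  have h2 : ∀ x : ℝ, ENNReal.ofReal (1 / ProbabilityTheory.beta α β * x ^ (α - 1) *
      (1 - x) ^ (β - 1)) = ENNReal.ofReal (1 / ProbabilityTheory.beta α β) *
        ENNReal.ofReal (x ^ (α - 1) * (1 - x) ^ (β - 1)) := fun x => by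
    rw [← ENNReal.ofReal_mul (by positivity), mul_assoc]
  simp_rw [h2] at h
  rw [lintegral_const_mul' _ _ ENNReal.ofReal_ne_top] at h
  have := congrArg (ENNReal.ofReal (ProbabilityTheory.beta α β) * ·) h
  simp only [mul_one] at this
  rwa [← mul_assoc, ← ENNReal.ofReal_mul hb.le, mul_one_div_cancel hb.ne', ENNReal.ofReal_one,
    one_mul] at this

/-- The substitution x = 1/(1+v²) turns the beta integral with parameters k - 1/2 and 1/2 into twice
this one. -/
lemma lintegral_Ioi_one_add_sq_rpow_neg {k : ℝ} (hk : 1 / 2 < k) :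
    ∫⁻ v in Ioi (0 : ℝ), ENNReal.ofReal ((1 + v ^ 2) ^ (-k)) =
      ENNReal.ofReal (ProbabilityTheory.beta (k - 1 / 2) (1 / 2) / 2) := by
  have himg : (fun v : ℝ => (1 + v ^ 2)⁻¹) '' Ioi (0 : ℝ) = Ioo 0 1 := by
    ext x
    simp only [mem_image, mem_Ioi, mem_Ioo]
    refine ⟨?_, fun ⟨h0, h1⟩ => ⟨√(x⁻¹ - 1), ?_, ?_⟩⟩
    · rintro ⟨z, hz, rfl⟩
      exact ⟨by positivity, inv_lt_one_of_one_lt₀ (by nlinarith)⟩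
    · have := (one_lt_inv₀ h0).2 h1
      exact Real.sqrt_pos.2 (by linarith)
    · have := (one_lt_inv₀ h0).2 h1
      rw [Real.sq_sqrt (by linarith)]
      simp
  have h := lintegral_Ioo_rpow_mul_rpow (α := k - 1 / 2) (β := 1 / 2) (by linarith) (by norm_num)
  rw [← himg, lintegral_image_eq_lintegral_abs_deriv_mul
    (f' := fun v => -(2 * v) / (1 + v ^ 2) ^ 2) measurableSet_Ioi] at h
  · have h2 : ∀ v ∈ Ioi (0 : ℝ), ENNReal.ofReal |-(2 * v) / (1 + v ^ 2) ^ 2| *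
        ENNReal.ofReal ((1 + v ^ 2)⁻¹ ^ (k - 1 / 2 - 1) *
          (1 - (1 + v ^ 2)⁻¹) ^ (1 / 2 - 1 : ℝ)) =
        ENNReal.ofReal 2 * ENNReal.ofReal ((1 + v ^ 2) ^ (-k)) := by
      intro v (hv : 0 < v)
      have hw : 0 < 1 + v ^ 2 := by positivity
      rw [← ENNReal.ofReal_mul (abs_nonneg _), ← ENNReal.ofReal_mul (by norm_num)]
      congr 1
      have e1 : 1 - (1 + v ^ 2)⁻¹ = v ^ (2 : ℝ) * (1 + v ^ 2) ^ (-1 : ℝ) := by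
        rw [Real.rpow_neg_one, Real.rpow_two]; field_simp; ring
      rw [e1, neg_div, abs_neg, abs_of_pos (by positivity), Real.mul_rpow (by positivity)
        (by positivity), ← Real.rpow_mul hv.le, ← Real.rpow_mul hw.le, ← Real.rpow_neg_one (1 + v ^ 2),
        ← Real.rpow_mul hw.le]
      have e2 : v ^ (2 * (1 / 2 - 1) : ℝ) = v⁻¹ := by
        rw [← Real.rpow_neg_one]; norm_num
      have e3 : ((1 + v ^ 2) ^ 2)⁻¹ = (1 + v ^ 2) ^ (-2 : ℝ) := by
        rw [Real.rpow_neg hw.le, Real.rpow_two]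
      rw [e2, div_eq_mul_inv, e3]
      calc _ = 2 * (v * v⁻¹) * ((1 + v ^ 2) ^ (-2 : ℝ) * (1 + v ^ 2) ^ (-1 * (k - 1 / 2 - 1)) *
            (1 + v ^ 2) ^ (-1 * (1 / 2 - 1) : ℝ)) := by ring
        _ = _ := by
          rw [mul_inv_cancel₀ hv.ne', ← Real.rpow_add hw, ← Real.rpow_add hw]
          ring_nf
    rw [setLIntegral_congr_fun measurableSet_Ioi h2,
      lintegral_const_mul' _ _ ENNReal.ofReal_ne_top] at h
    rw [div_eq_inv_mul, ENNReal.ofReal_mul (by norm_num), ← h, ← mul_assoc,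
      ← ENNReal.ofReal_mul (by norm_num)]
    norm_num
  · intro v _
    have hd : HasDerivAt (fun v : ℝ => 1 + v ^ 2) (2 * v) v := by
      simpa using ((hasDerivAt_id v).pow 2).const_add 1
    exact (hd.inv (by positivity)).hasDerivWithinAt
  · intro x (hx : 0 < x) y (hy : 0 < y) h
    simp only [inv_inj, add_right_inj] at h
    exact (pow_left_inj₀ hx.le hy.le two_ne_zero).1 h

lemma lintegral_one_add_sq_rpow_neg {k : ℝ} (hk : 1 / 2 < k) :
    ∫⁻ v : ℝ, ENNReal.ofReal ((1 + v ^ 2) ^ (-k)) =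
      ENNReal.ofReal (ProbabilityTheory.beta (k - 1 / 2) (1 / 2)) := by
  have h := lintegral_Ioi_one_add_sq_rpow_neg hk
  have himg : (fun v : ℝ => -v) '' Ioi (0 : ℝ) = Iio 0 := by simp
  have hb : 0 ≤ ProbabilityTheory.beta (k - 1 / 2) (1 / 2) / 2 :=
    div_nonneg (ProbabilityTheory.beta_pos (by linarith) (by norm_num)).le (by norm_num)
  have hneg : ∫⁻ v in Iio (0 : ℝ), ENNReal.ofReal ((1 + v ^ 2) ^ (-k)) =
      ∫⁻ v in Ioi (0 : ℝ), ENNReal.ofReal ((1 + v ^ 2) ^ (-k)) := by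
    rw [← himg, lintegral_image_eq_lintegral_abs_deriv_mul (f := fun v => -v) (f' := fun _ => -1)
      measurableSet_Ioi (fun x _ => (hasDerivAt_id x).neg.hasDerivWithinAt) neg_injective.injOn]
    simp
  rw [← lintegral_add_compl _ (measurableSet_Ioi (a := (0 : ℝ))), compl_Ioi,
    setLIntegral_congr (Iio_ae_eq_Iic (a := (0 : ℝ))).symm, hneg, h,
    ← ENNReal.ofReal_add hb hb]
  ring_nf

/-- The substitution `w = n z - m / z` maps the half-line onto the line. -/
lemma lintegral_comp_mul_sub_div (g : ℝ → ℝ≥0∞) {m n : ℝ} (hm : 0 < m) (hn : 0 < n) :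
    ∫⁻ w : ℝ, g w =
      ∫⁻ z in Ioi 0, ENNReal.ofReal (n + m / z ^ 2) * g (n * z - m / z) := by
  have hder : ∀ z : ℝ, 0 < z → HasDerivAt (fun z => n * z - m / z) (n + m / z ^ 2) z := by
    intro z hz
    convert! ((hasDerivAt_id z).const_mul n).sub ((hasDerivAt_inv hz.ne').const_mul m) using 1
    field_simp
    ring
  have himg : (fun z : ℝ => n * z - m / z) '' Ioi (0 : ℝ) = univ := by
    refine eq_univ_of_forall fun w => ?_
    -- The preimage of w is the positive root of n z² - w z - m = 0.
    have hd : |w| < √(w ^ 2 + 4 * m * n) := by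
      rw [← Real.sqrt_sq_eq_abs]
      exact Real.sqrt_lt_sqrt (sq_nonneg _) (by nlinarith [mul_pos hm hn])
    have hs : √(w ^ 2 + 4 * m * n) ^ 2 = w ^ 2 + 4 * m * n := Real.sq_sqrt (by positivity)
    have hpos : 0 < w + √(w ^ 2 + 4 * m * n) := by
      have := neg_abs_le w
      linarith
    refine ⟨(w + √(w ^ 2 + 4 * m * n)) / (2 * n), div_pos hpos (by positivity), ?_⟩
    simp only
    generalize √(w ^ 2 + 4 * m * n) = d at *
    field_simp
    nlinarith
  have hinj : InjOn (fun z : ℝ => n * z - m / z) (Ioi 0) := by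
    intro x (hx : 0 < x) y (hy : 0 < y) h
    simp only at h
    have : (x - y) * (n + m / (x * y)) = 0 := by
      have e : (x - y) * (n + m / (x * y)) = (n * x - m / x) - (n * y - m / y) := by
        field_simp
        ring
      rw [e, h, sub_self]
    rcases mul_eq_zero.1 this with h | h
    · linarith
    · exact absurd h (by positivity)
  rw [← setLIntegral_univ, ← himg, lintegral_image_eq_lintegral_abs_deriv_mul
    (f' := fun z => n + m / z ^ 2) measurableSet_Ioi
    (fun z hz => (hder z hz).hasDerivWithinAt) hinj]
  refine setLIntegral_congr_fun measurableSet_Ioi fun x (hx : 0 < x) => ?_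
  rw [abs_of_pos (by positivity)]

end ResourceModel

/-! ### The radial and the angular integral. -/

namespace ResourceModel

open Set

/-- The integral of `(1 - x H)₊ x ^ (c - 1)` over the half-line. -/
lemma lintegral_Ioi_one_sub_mul_rpow {c H : ℝ} (hc : 0 < c) (hH : 0 < H) :
    ∫⁻ x in Ioi (0 : ℝ), ENNReal.ofReal (1 - x * H) * ENNReal.ofReal (x ^ (c - 1)) =
      ENNReal.ofReal (H ^ (-c) / (c * (c + 1))) := by
  have hbeta : ProbabilityTheory.beta c 2 = 1 / (c * (c + 1)) := by
    rw [ProbabilityTheory.beta, Real.Gamma_two, show c + 2 = (c + 1) + 1 by ring,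
      Real.Gamma_add_one (by positivity), Real.Gamma_add_one hc.ne']
    have := (Real.Gamma_pos_of_pos hc).ne'
    field_simp
  -- Rescaling by 1/H extracts H^(-c) and leaves the beta integral with parameters c and 2.
  rw [lintegral_Ioi_comp_mul_left _ (inv_pos.2 hH)]
  have h1 : ∀ x ∈ Ioi (0 : ℝ), ENNReal.ofReal H⁻¹ * (ENNReal.ofReal (1 - H⁻¹ * x * H) *
      ENNReal.ofReal ((H⁻¹ * x) ^ (c - 1))) =
      ENNReal.ofReal (H ^ (-c)) * (ENNReal.ofReal (1 - x) * ENNReal.ofReal (x ^ (c - 1))) := by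
    intro x (hx : 0 < x)
    have e : H ^ (-c) = H⁻¹ * H⁻¹ ^ (c - 1) := by
      rw [Real.rpow_sub_one (by positivity), Real.inv_rpow hH.le, Real.rpow_neg hH.le]
      field_simp
    rw [Real.mul_rpow (by positivity) hx.le, show 1 - H⁻¹ * x * H = 1 - x by field_simp, e,
      ENNReal.ofReal_mul (by positivity), ENNReal.ofReal_mul (by positivity)]
    ring
  rw [setLIntegral_congr_fun measurableSet_Ioi h1,
    lintegral_const_mul' _ _ ENNReal.ofReal_ne_top]
  have h2 : ∫⁻ x in Ioi (0 : ℝ), ENNReal.ofReal (1 - x) * ENNReal.ofReal (x ^ (c - 1)) =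
      ∫⁻ x in Ioo (0 : ℝ) 1, ENNReal.ofReal (x ^ (c - 1) * (1 - x) ^ (2 - 1 : ℝ)) := by
    rw [← lintegral_indicator measurableSet_Ioi, ← lintegral_indicator measurableSet_Ioo]
    refine lintegral_congr fun x => ?_
    by_cases h0 : 0 < x
    · by_cases h1 : x < 1
      · rw [indicator_of_mem (mem_Ioi.2 h0), indicator_of_mem (mem_Ioo.2 ⟨h0, h1⟩),
          ← ENNReal.ofReal_mul (by linarith)]
        norm_num [mul_comm]
      · rw [indicator_of_mem (mem_Ioi.2 h0), indicator_of_notMem (fun h => h1 h.2),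
          ENNReal.ofReal_of_nonpos (by linarith), zero_mul]
    · rw [indicator_of_notMem (fun h : x ∈ Ioi 0 => h0 h), indicator_of_notMem (fun h => h0 h.1)]
  rw [h2, lintegral_Ioo_rpow_mul_rpow hc two_pos, hbeta, ← ENNReal.ofReal_mul (by positivity),
    mul_one_div]

/-- The constant of the angular integral. -/
lemma beta_half_mul_beta_half {b : ℝ} (hb : 0 < b) :
    2 ^ (b - 2) / Real.pi * b * ProbabilityTheory.beta (b / 2) (b / 2) *
      ProbabilityTheory.beta (b / 2 + 1 / 2) (1 / 2) = 1 := by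
  -- Legendre's duplication formula; it accounts for the power of 2 and for π in the constant.
  have h := Real.Gamma_mul_Gamma_add_half (b / 2)
  have h2 : (2 : ℝ) ^ (b - 2) * 2 ^ (1 - b) = 1 / 2 := by
    rw [← Real.rpow_add two_pos, show b - 2 + (1 - b) = -1 by ring, Real.rpow_neg_one]
    norm_num
  have hG := Real.Gamma_pos_of_pos hb
  have hG2 := Real.Gamma_pos_of_pos (half_pos hb)
  have hπ := Real.sqrt_pos.2 Real.pi_pos
  have hπ2 := Real.sq_sqrt Real.pi_pos.le
  rw [ProbabilityTheory.beta, ProbabilityTheory.beta, Real.Gamma_one_half_eq, add_halves,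
    show b / 2 + 1 / 2 + 1 / 2 = b / 2 + 1 by ring, Real.Gamma_add_one (by positivity)]
  rw [show 2 * (b / 2) = b by ring] at h
  generalize Real.Gamma (b / 2 + 1 / 2) = G' at *
  generalize Real.Gamma (b / 2) = G at *
  generalize Real.Gamma b = G'' at *
  generalize (2 : ℝ) ^ (b - 2) = r at *
  generalize (2 : ℝ) ^ (1 - b) = r' at *
  generalize √Real.pi = q at *
  rw [← hπ2]
  field_simp
  linear_combination 2 * r * h + 2 * G'' * q * h2

/-- The integrand is φ(nz - m/z)/(1+z²) with φ even, because (m+n)² + (nz - m/z)² = (1+z²)(m² +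
n²z²)/z². The involution z ↦ m/(nz) only changes the sign of nz - m/z, so it gives a second
expression for the same integral. In the sum of the two the weights combine to a multiple of n +
m/z², the derivative of nz - m/z, and the integral passes to the whole line. -/
lemma angular_integral {b m n : ℝ} (hb : 0 < b) (hm : 0 < m) (hn : 0 < n) :
    2 * ∫⁻ z in Ioi (0 : ℝ), ENNReal.ofReal
      (z ^ b * (1 + z ^ 2) ^ (-(b / 2) - 1) * (m ^ 2 + n ^ 2 * z ^ 2) ^ (-(b / 2))) =
      ENNReal.ofReal ((m + n) ^ (-b) * ProbabilityTheory.beta (b / 2 + 1 / 2) (1 / 2)) := by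
  set φ : ℝ → ℝ := fun w => ((m + n) ^ 2 + w ^ 2) ^ (-(b / 2)) with hφ
  have hφpos : ∀ w, 0 < φ w := fun w => by positivity
  have hφm : Measurable φ := by fun_prop
  have hφneg : ∀ w, φ (-w) = φ w := fun w => by simp [φ]
  have h1 : ∀ z ∈ Ioi (0 : ℝ), ENNReal.ofReal
      (z ^ b * (1 + z ^ 2) ^ (-(b / 2) - 1) * (m ^ 2 + n ^ 2 * z ^ 2) ^ (-(b / 2))) =
      ENNReal.ofReal (φ (n * z - m / z) / (1 + z ^ 2)) := by
    intro z (hz : 0 < z)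
    congr 1
    have e : (m + n) ^ 2 + (n * z - m / z) ^ 2 =
        (1 + z ^ 2) * (m ^ 2 + n ^ 2 * z ^ 2) * z ^ (-2 : ℝ) := by
      rw [Real.rpow_neg hz.le, Real.rpow_two]
      field_simp
      ring
    simp only [hφ]
    rw [e, Real.mul_rpow (by positivity) (by positivity), Real.mul_rpow (by positivity)
      (by positivity), ← Real.rpow_mul hz.le, Real.rpow_sub_one (by positivity)]
    ring_nf
  -- The involution z ↦ m/(nz), together with the evenness of φ.
  have h2 : ∫⁻ z in Ioi (0 : ℝ), ENNReal.ofReal (φ (n * z - m / z) / (1 + z ^ 2)) =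
      ∫⁻ z in Ioi (0 : ℝ), ENNReal.ofReal
        (φ (n * z - m / z) * (m * n / (n ^ 2 * z ^ 2 + m ^ 2))) := by
    rw [lintegral_Ioi_comp_div _ (div_pos hm hn)]
    refine setLIntegral_congr_fun measurableSet_Ioi fun z (hz : 0 < z) => ?_
    rw [← ENNReal.ofReal_mul (by positivity)]
    congr 1
    rw [show n * (m / n / z) - m / (m / n / z) = -(n * z - m / z) by field_simp; ring, hφneg]
    field_simp
  have h3 : ∀ w, (m + n) * φ w / ((m + n) ^ 2 + w ^ 2) =
      (m + n) * ((m + n) ^ 2 + w ^ 2) ^ (-(b / 2 + 1)) := fun w => by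
    simp only [hφ]
    rw [show -(b / 2 + 1) = -(b / 2) - 1 by ring, Real.rpow_sub_one (by positivity)]
    ring
  have hbeta := lintegral_one_add_sq_rpow_neg (k := b / 2 + 1) (by linarith)
  rw [setLIntegral_congr_fun measurableSet_Ioi h1, two_mul]
  nth_rewrite 2 [h2]
  rw [← lintegral_add_left (by fun_prop)]
  -- The weights add up by n²z² + m² + mn(1+z²) = (m+n)(nz² + m).
  calc _ = ∫⁻ z in Ioi (0 : ℝ), ENNReal.ofReal (n + m / z ^ 2) *
        ENNReal.ofReal ((m + n) * φ (n * z - m / z) / ((m + n) ^ 2 + (n * z - m / z) ^ 2)) := by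
        refine setLIntegral_congr_fun measurableSet_Ioi fun z (hz : 0 < z) => ?_
        have := hφpos (n * z - m / z)
        rw [← ENNReal.ofReal_add (by positivity) (by positivity),
          ← ENNReal.ofReal_mul (by positivity)]
        congr 1
        rw [show (m + n) ^ 2 + (n * z - m / z) ^ 2 =
          (1 + z ^ 2) * (n ^ 2 * z ^ 2 + m ^ 2) / z ^ 2 by field_simp; ring]
        field_simp
        ring
    _ = ∫⁻ w : ℝ, ENNReal.ofReal ((m + n) * φ w / ((m + n) ^ 2 + w ^ 2)) :=
        (lintegral_comp_mul_sub_div (fun w => ENNReal.ofReal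
          ((m + n) * φ w / ((m + n) ^ 2 + w ^ 2))) hm hn).symm
    _ = ENNReal.ofReal ((m + n) ^ (-b)) *
        ∫⁻ v : ℝ, ENNReal.ofReal ((1 + v ^ 2) ^ (-(b / 2 + 1))) := by
        have hk : 0 < m + n := by positivity
        have himg : (fun v : ℝ => (m + n) * v) '' univ = univ :=
          image_univ_of_surjective fun w => ⟨w / (m + n), by field_simp⟩
        rw [← setLIntegral_univ, ← himg, lintegral_image_eq_lintegral_abs_deriv_mul
          (f' := fun _ => m + n) MeasurableSet.univ
          (fun x _ => (hasDerivAt_const_mul (m + n)).hasDerivWithinAt)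
          (mul_right_injective₀ hk.ne').injOn, setLIntegral_univ,
          ← lintegral_const_mul' _ _ ENNReal.ofReal_ne_top]
        refine lintegral_congr fun v => ?_
        rw [h3, ← ENNReal.ofReal_mul (by positivity), ← ENNReal.ofReal_mul (by positivity),
          abs_of_pos hk]
        congr 1
        rw [show (m + n) ^ 2 + ((m + n) * v) ^ 2 = (m + n) ^ (2 : ℝ) * (1 + v ^ 2) by
          rw [Real.rpow_two]; ring, Real.mul_rpow (by positivity) (by positivity),
          ← Real.rpow_mul hk.le, show 2 * -(b / 2 + 1) = -b - 1 - 1 by ring,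
          Real.rpow_sub_one hk.ne', Real.rpow_sub_one hk.ne']
        field_simp
    _ = _ := by
        rw [hbeta, ← ENNReal.ofReal_mul (by positivity)]
        ring_nf

end ResourceModel

/-! ### The profit integral for the given distribution of capacities. -/

namespace ResourceModel

open Set

lemma measurableSet_quadrant : MeasurableSet {x : Fin 2 → ℝ | ∀ j, 0 < x j} := by
  simp only [ofPred_forall]
  exact MeasurableSet.iInter fun j => measurableSet_lt measurable_const (measurable_pi_apply j)

lemma measurable_capacityDensity (α₁ α₂ ρ γ : ℝ) : Measurable (capacityDensity α₁ α₂ ρ γ) := by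
  unfold capacityDensity
  fun_prop

lemma measurable_cesUnitCost (s : ℝ) : Measurable (cesUnitCost s) := by
  unfold cesUnitCost
  fun_prop

/-- Integration over the open quadrant in the coordinates `x` and `t = y / x`. -/
lemma lintegral_quadrant {Φ : (Fin 2 → ℝ) → ℝ≥0∞} (hΦ : Measurable Φ) :
    ∫⁻ x in {x : Fin 2 → ℝ | ∀ j, 0 < x j}, Φ x =
      ∫⁻ t in Ioi (0 : ℝ), ∫⁻ x in Ioi (0 : ℝ), ENNReal.ofReal x * Φ ![x, x * t] := by
  have hmeas : Measurable fun q : ℝ × ℝ => (![q.1, q.2] : Fin 2 → ℝ) := by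
    rw [measurable_pi_iff]
    intro j
    fin_cases j
    · exact measurable_fst
    · exact measurable_snd
  have hpre : (MeasurableEquiv.finTwoArrow (α := ℝ)).symm ⁻¹' {x : Fin 2 → ℝ | ∀ j, 0 < x j} =
      Ioi 0 ×ˢ Ioi 0 := by
    ext q
    simp [Fin.forall_fin_two]
  have h := (volume_preserving_finTwoArrow ℝ).symm.setLIntegral_comp_preimage_emb
    (MeasurableEquiv.measurableEmbedding _) Φ {x : Fin 2 → ℝ | ∀ j, 0 < x j}
  rw [← h, hpre, Measure.volume_eq_prod, ← Measure.prod_restrict]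
  have e : ∀ q : ℝ × ℝ, (MeasurableEquiv.finTwoArrow (α := ℝ)).symm q = ![q.1, q.2] := fun q => rfl
  simp_rw [e]
  rw [lintegral_prod (fun q : ℝ × ℝ => Φ ![q.1, q.2]) (hΦ.comp hmeas).aemeasurable]
  calc _ = ∫⁻ x in Ioi (0 : ℝ), ∫⁻ t in Ioi (0 : ℝ), ENNReal.ofReal x * Φ ![x, x * t] :=
        setLIntegral_congr_fun measurableSet_Ioi fun x hx =>
          lintegral_Ioi_comp_mul_left (fun y => Φ ![x, y]) hx
    _ = _ := by
        refine lintegral_lintegral_swap (Measurable.aemeasurable ?_)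
        exact (by fun_prop : Measurable fun q : ℝ × ℝ => ENNReal.ofReal q.1).mul
          (hΦ.comp (hmeas.comp (by fun_prop : Measurable fun q : ℝ × ℝ => (q.1, q.1 * q.2))))

lemma cesUnitCost_smul {s : ℝ} (hs : 0 < s) {t : ℝ} (ht : 0 ≤ t) {q : Fin 2 → ℝ} (hq : 0 ≤ q) :
    cesUnitCost s (t • q) = t * cesUnitCost s q := by
  have h0 := hq 0
  have h1 := hq 1
  simp only [Pi.zero_apply] at h0 h1
  simp only [cesUnitCost, Pi.smul_apply, smul_eq_mul]
  rw [Real.mul_rpow ht h0, Real.mul_rpow ht h1, ← mul_add, Real.mul_rpow (by positivity)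
    (by positivity), ← Real.rpow_mul ht, mul_one_div_cancel hs.ne', Real.rpow_one]

/-- The profit function of the CES production function. -/
noncomputable def cesProfit (α₁ α₂ ρ γ : ℝ) (p : Fin 2 → ℝ) : ℝ :=
  (1 - γ) * γ ^ (γ / (1 - γ)) *
    (α₁ ^ (1 / (1 + ρ)) * p 0 ^ (ρ / (1 + ρ)) + α₂ ^ (1 / (1 + ρ)) * p 1 ^ (ρ / (1 + ρ))) ^
      (-expB ρ γ)

section

variable {α₁ α₂ ρ γ : ℝ}

lemma expB_pos (hρ : 0 < ρ) (hγ₀ : 0 < γ) (hγ₁ : γ < 1) : 0 < expB ρ γ := by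
  have : 0 < 1 - γ := by linarith
  unfold expB
  positivity

/-- The beta and π factors of B_ρ are there to cancel the beta value left by the angular integral.
-/
lemma capacityConst_mul (hρ : 0 < ρ) (hγ₀ : 0 < γ) (hγ₁ : γ < 1) :
    capacityConst α₁ α₂ ρ γ * ProbabilityTheory.beta (expB ρ γ / 2 + 1 / 2) (1 / 2) =
      2 * ρ / (1 + ρ) * (γ ^ (1 / (1 - γ)) / (1 - γ)) * (α₁ * α₂) ^ (1 / (1 + ρ)) := by
  have h := beta_half_mul_beta_half (expB_pos hρ hγ₀ hγ₁)
  unfold capacityConst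
  linear_combination
    2 * ρ / (1 + ρ) * (γ ^ (1 / (1 - γ)) / (1 - γ)) * (α₁ * α₂) ^ (1 / (1 + ρ)) * h

lemma capacityConst_pos (hρ : 0 < ρ) (hγ₀ : 0 < γ) (hγ₁ : γ < 1) (hα₁ : 0 < α₁)
    (hα₂ : 0 < α₂) : 0 < capacityConst α₁ α₂ ρ γ := by
  have hb := expB_pos hρ hγ₀ hγ₁
  have := ProbabilityTheory.beta_pos (half_pos hb) (half_pos hb)
  have : 0 < 1 - γ := by linarith
  unfold capacityConst
  positivity

/-- The density of capacities in the coordinates `x` and `t = y / x`. -/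
lemma capacityDensity_homogeneous (hρ : 0 < ρ) (hα₁ : 0 < α₁) (hα₂ : 0 < α₂) {x t : ℝ} (hx : 0 < x)
    (ht : 0 < t) :
    x * capacityDensity α₁ α₂ ρ γ ![x, x * t] =
      capacityConst α₁ α₂ ρ γ * (t ^ (-(ρ / (1 + ρ)) - 1) *
        (α₁ ^ (2 / (1 + ρ)) + α₂ ^ (2 / (1 + ρ)) * t ^ (-(2 * ρ / (1 + ρ)))) ^
          (-(expB ρ γ / 2) - 1)) * x ^ (γ / (1 - γ) - 1) := by
  simp only [capacityDensity, Matrix.cons_val_zero, Matrix.cons_val_one]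
  have e1 : -(γ / (1 - γ) * ((1 + ρ) / (2 * ρ))) - 1 = -(expB ρ γ / 2) - 1 := by
    unfold expB; field_simp
  -- Ties the radial exponent to the exponent b of the angular part.
  have e2 : γ / (1 - γ) = ρ / (1 + ρ) * expB ρ γ := by
    unfold expB; field_simp
  rw [e1, e2, Real.mul_rpow hx.le ht.le (z := -(2 * ρ / (1 + ρ))),
    show α₁ ^ (2 / (1 + ρ)) * x ^ (-(2 * ρ / (1 + ρ))) + α₂ ^ (2 / (1 + ρ)) *
      (x ^ (-(2 * ρ / (1 + ρ))) * t ^ (-(2 * ρ / (1 + ρ)))) = x ^ (-(2 * ρ / (1 + ρ))) *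
      (α₁ ^ (2 / (1 + ρ)) + α₂ ^ (2 / (1 + ρ)) * t ^ (-(2 * ρ / (1 + ρ)))) by ring,
    Real.mul_rpow (by positivity) (by positivity) (z := -(expB ρ γ / 2) - 1),
    ← mul_assoc x x t, Real.mul_rpow (by positivity) ht.le (z := -(ρ / (1 + ρ)) - 1),
    Real.mul_rpow hx.le hx.le, ← Real.rpow_mul hx.le]
  have e3 : x ^ (ρ / (1 + ρ) * expB ρ γ - 1) = x * (x ^ (-(ρ / (1 + ρ)) - 1) *
      x ^ (-(ρ / (1 + ρ)) - 1)) * x ^ (-(2 * ρ / (1 + ρ)) * (-(expB ρ γ / 2) - 1)) := by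
    nth_rewrite 2 [← Real.rpow_one x]
    rw [← Real.rpow_add hx, ← Real.rpow_add hx, ← Real.rpow_add hx]
    congr 1
    field_simp
    ring
  rw [e3]
  ring

/-- The angular part of the profit integral. -/
lemma lintegral_angular {b a₁ a₂ p₁ p₂ : ℝ} (hb : 0 < b) (ha₁ : 0 < a₁)
    (ha₂ : 0 < a₂) (hp₁ : 0 < p₁) (hp₂ : 0 < p₂) {σ : ℝ} (hσ : 0 < σ) :
    ∫⁻ t in Ioi (0 : ℝ), ENNReal.ofReal (t ^ (-σ - 1) *
      (a₁ ^ 2 + a₂ ^ 2 * t ^ (-(2 * σ))) ^ (-(b / 2) - 1) *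
        (p₁ ^ (2 * σ) + p₂ ^ (2 * σ) * t ^ (2 * σ)) ^ (-(b / 2))) =
      ENNReal.ofReal ((a₁ * p₁ ^ σ + a₂ * p₂ ^ σ) ^ (-b) *
        ProbabilityTheory.beta (b / 2 + 1 / 2) (1 / 2) / (2 * σ * a₁ * a₂)) := by
  have hI := angular_integral hb (m := a₁ * p₁ ^ σ) (n := a₂ * p₂ ^ σ) (by positivity)
    (by positivity)
  -- The substitution t^σ = (a₂/a₁) z turns a₁² + a₂² t^(-2σ) into a₁²(1+z²)/z² and the price factor
  -- into a multiple of m² + n²z², with m = a₁p₁^σ and n = a₂p₂^σ.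
  rw [lintegral_Ioi_comp_rpow _ (inv_pos.2 hσ), lintegral_Ioi_comp_mul_left _ (div_pos ha₂ ha₁)]
  have hpt : ∀ z ∈ Ioi (0 : ℝ), ENNReal.ofReal (a₂ / a₁) *
      (ENNReal.ofReal (σ⁻¹ * (a₂ / a₁ * z) ^ (σ⁻¹ - 1)) *
        ENNReal.ofReal (((a₂ / a₁ * z) ^ σ⁻¹) ^ (-σ - 1) *
          (a₁ ^ 2 + a₂ ^ 2 * ((a₂ / a₁ * z) ^ σ⁻¹) ^ (-(2 * σ))) ^ (-(b / 2) - 1) *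
            (p₁ ^ (2 * σ) + p₂ ^ (2 * σ) * ((a₂ / a₁ * z) ^ σ⁻¹) ^ (2 * σ)) ^ (-(b / 2)))) =
      ENNReal.ofReal (1 / (2 * σ * a₁ * a₂)) * 2 * ENNReal.ofReal
        (z ^ b * (1 + z ^ 2) ^ (-(b / 2) - 1) *
          ((a₁ * p₁ ^ σ) ^ 2 + (a₂ * p₂ ^ σ) ^ 2 * z ^ 2) ^ (-(b / 2))) := by
    intro z (hz : 0 < z)
    have hy : 0 < a₂ / a₁ * z := by positivity
    have e1 : ((a₂ / a₁ * z) ^ σ⁻¹) ^ (-(2 * σ)) = ((a₂ / a₁ * z) ^ 2)⁻¹ := by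
      rw [← Real.rpow_mul hy.le, show σ⁻¹ * -(2 * σ) = -2 by field_simp, Real.rpow_neg hy.le,
        Real.rpow_two]
    have e2 : ((a₂ / a₁ * z) ^ σ⁻¹) ^ (2 * σ) = (a₂ / a₁ * z) ^ 2 := by
      rw [← Real.rpow_mul hy.le, show σ⁻¹ * (2 * σ) = 2 by field_simp, Real.rpow_two]
    have e3 : (a₂ / a₁ * z) ^ (σ⁻¹ - 1) * ((a₂ / a₁ * z) ^ σ⁻¹) ^ (-σ - 1) =
        ((a₂ / a₁ * z) ^ 2)⁻¹ := by
      rw [← Real.rpow_mul hy.le, ← Real.rpow_add hy,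
        show σ⁻¹ - 1 + σ⁻¹ * (-σ - 1) = -2 by field_simp; ring, Real.rpow_neg hy.le,
        Real.rpow_two]
    have e4 : a₁ ^ 2 + a₂ ^ 2 * ((a₂ / a₁ * z) ^ 2)⁻¹ =
        a₁ ^ (2 : ℝ) * (1 + z ^ 2) * z ^ (-2 : ℝ) := by
      rw [Real.rpow_neg hz.le, Real.rpow_two, Real.rpow_two]
      field_simp
      ring
    have e5 : p₁ ^ (2 * σ) + p₂ ^ (2 * σ) * (a₂ / a₁ * z) ^ 2 =
        a₁ ^ (-2 : ℝ) * ((a₁ * p₁ ^ σ) ^ 2 + (a₂ * p₂ ^ σ) ^ 2 * z ^ 2) := by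
      rw [Real.rpow_neg ha₁.le, Real.rpow_two, mul_comm 2 σ, Real.rpow_mul hp₁.le,
        Real.rpow_mul hp₂.le, Real.rpow_two, Real.rpow_two]
      field_simp
    have e6 : (a₁ ^ (2 : ℝ)) ^ (-(b / 2) - 1) * (a₁ ^ (-2 : ℝ)) ^ (-(b / 2)) = (a₁ ^ 2)⁻¹ := by
      rw [← Real.rpow_mul ha₁.le, ← Real.rpow_mul ha₁.le, ← Real.rpow_add ha₁,
        show 2 * (-(b / 2) - 1) + -2 * -(b / 2) = -2 by ring, Real.rpow_neg ha₁.le,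
        Real.rpow_two]
    have e7 : (z ^ (-2 : ℝ)) ^ (-(b / 2) - 1) = z ^ b * z ^ 2 := by
      rw [← Real.rpow_mul hz.le, ← Real.rpow_two, ← Real.rpow_add hz]
      ring_nf
    rw [e1, e2, e4, e5,
      Real.mul_rpow (x := a₁ ^ (2 : ℝ) * (1 + z ^ 2)) (by positivity) (by positivity),
      Real.mul_rpow (x := a₁ ^ (2 : ℝ)) (by positivity) (by positivity),
      Real.mul_rpow (x := a₁ ^ (-2 : ℝ)) (by positivity) (by positivity), e7,
      show (2 : ℝ≥0∞) = ENNReal.ofReal 2 by simp, ← ENNReal.ofReal_mul (by positivity),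
      ← ENNReal.ofReal_mul (by positivity), ← ENNReal.ofReal_mul (by positivity),
      ← ENNReal.ofReal_mul (by positivity)]
    congr 1
    generalize (1 + z ^ 2) ^ (-(b / 2) - 1) = X
    generalize ((a₁ * p₁ ^ σ) ^ 2 + (a₂ * p₂ ^ σ) ^ 2 * z ^ 2) ^ (-(b / 2)) = Y
    calc _ = a₂ / a₁ * σ⁻¹ * ((a₂ / a₁ * z) ^ (σ⁻¹ - 1) *
          ((a₂ / a₁ * z) ^ σ⁻¹) ^ (-σ - 1)) * ((a₁ ^ (2 : ℝ)) ^ (-(b / 2) - 1) *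
          (a₁ ^ (-2 : ℝ)) ^ (-(b / 2))) * X * (z ^ b * z ^ 2) * Y := by ring
      _ = _ := by
        rw [e3, e6]
        field_simp
  rw [setLIntegral_congr_fun measurableSet_Ioi hpt, lintegral_const_mul' _ _
    (ENNReal.mul_ne_top ENNReal.ofReal_ne_top ENNReal.ofNat_ne_top), mul_assoc, hI,
    ← ENNReal.ofReal_mul (by positivity)]
  ring_nf

lemma lintegral_profit (hρ : 0 < ρ) (hγ₀ : 0 < γ) (hγ₁ : γ < 1) (hα₁ : 0 < α₁) (hα₂ : 0 < α₂)
    {p : Fin 2 → ℝ} (hp : ∀ j, 0 < p j) :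
    ∫⁻ x, ENNReal.ofReal (1 - cesUnitCost (2 * ρ / (1 + ρ)) (p * x))
      ∂capacityMeasure α₁ α₂ ρ γ = ENNReal.ofReal (cesProfit α₁ α₂ ρ γ p) := by
  have hb := expB_pos hρ hγ₀ hγ₁
  have hγ' : 0 < 1 - γ := by linarith
  have hc : 0 < γ / (1 - γ) := by positivity
  have hB := capacityConst_pos hρ hγ₀ hγ₁ hα₁ hα₂
  have hp0 := hp 0
  have hp1 := hp 1
  set s := 2 * ρ / (1 + ρ) with hs
  have hs0 : 0 < s := by positivity
  set σ := ρ / (1 + ρ) with hσ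
  have hσ0 : 0 < σ := by positivity
  have hsσ : s = 2 * σ := by rw [hs, hσ]; ring
  set b := expB ρ γ with hbdef
  set c := γ / (1 - γ) with hcdef
  have hcb : c = σ * b := by rw [hcdef, hσ, hbdef, expB]; field_simp
  set a₁ := α₁ ^ (1 / (1 + ρ)) with ha₁
  set a₂ := α₂ ^ (1 / (1 + ρ)) with ha₂
  have ha₁0 : 0 < a₁ := by positivity
  have ha₂0 : 0 < a₂ := by positivity
  have hcost : Measurable fun x : Fin 2 → ℝ => ENNReal.ofReal (1 - cesUnitCost s (p * x)) :=
    (measurable_const.sub ((measurable_cesUnitCost s).comp (by fun_prop))).ennreal_ofReal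
  have hdens := (measurable_capacityDensity α₁ α₂ ρ γ).ennreal_ofReal
  rw [capacityMeasure, lintegral_withDensity_eq_lintegral_mul _ hdens hcost,
    lintegral_quadrant (hdens.mul hcost)]
  -- On the ray of slope t the unit cost is x·H with H the cost at (1, t), so the radial integral
  -- gives H^(-c), a power of the CES sum since c = σb and s = 2σ.
  have hin : ∀ t ∈ Ioi (0 : ℝ), ∫⁻ x in Ioi (0 : ℝ), ENNReal.ofReal x *
      ((fun x => ENNReal.ofReal (capacityDensity α₁ α₂ ρ γ x)) *
        fun x => ENNReal.ofReal (1 - cesUnitCost s (p * x))) ![x, x * t] =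
      ENNReal.ofReal (capacityConst α₁ α₂ ρ γ / (c * (c + 1))) *
      ENNReal.ofReal (t ^ (-σ - 1) * (a₁ ^ 2 + a₂ ^ 2 * t ^ (-(2 * σ))) ^ (-(b / 2) - 1) *
        (p 0 ^ (2 * σ) + p 1 ^ (2 * σ) * t ^ (2 * σ)) ^ (-(b / 2))) := by
    intro t (ht : 0 < t)
    have hH : 0 < cesUnitCost s (p * ![1, t]) := by
      simp only [cesUnitCost, Pi.mul_apply, Matrix.cons_val_zero, Matrix.cons_val_one]
      positivity
    have hHc : cesUnitCost s (p * ![1, t]) ^ (-c) =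
        (p 0 ^ (2 * σ) + p 1 ^ (2 * σ) * t ^ (2 * σ)) ^ (-(b / 2)) := by
      simp only [cesUnitCost, Pi.mul_apply, Matrix.cons_val_zero, Matrix.cons_val_one, mul_one]
      rw [← Real.rpow_mul (by positivity), Real.mul_rpow hp1.le ht.le, hsσ, hcb]
      congr 1
      field_simp
    have hα : ∀ α : ℝ, 0 < α → α ^ (2 / (1 + ρ)) = (α ^ (1 / (1 + ρ))) ^ 2 := by
      intro α hα
      rw [← Real.rpow_natCast, ← Real.rpow_mul hα.le]
      congr 1
      push_cast
      ring
    set θ := t ^ (-σ - 1) * (a₁ ^ 2 + a₂ ^ 2 * t ^ (-(2 * σ))) ^ (-(b / 2) - 1) with hθ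
    have hθ0 : 0 < θ := by positivity
    have hpt : ∀ x ∈ Ioi (0 : ℝ), ENNReal.ofReal x *
      ((fun x => ENNReal.ofReal (capacityDensity α₁ α₂ ρ γ x)) *
        fun x => ENNReal.ofReal (1 - cesUnitCost s (p * x))) ![x, x * t] =
        ENNReal.ofReal (capacityConst α₁ α₂ ρ γ * θ) *
          (ENNReal.ofReal (1 - x * cesUnitCost s (p * ![1, t])) *
            ENNReal.ofReal (x ^ (c - 1))) := by
      intro x (hx : 0 < x)
      have h1 : p * ![x, x * t] = x • (p * ![1, t]) := by
        ext j; fin_cases j <;> simp <;> ring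
      have h2 : (0 : Fin 2 → ℝ) ≤ p * ![1, t] := by
        intro j; fin_cases j <;> simp <;> positivity
      have h3 := capacityDensity_homogeneous (γ := γ) hρ hα₁ hα₂ hx ht
      rw [hα α₁ hα₁, hα α₂ hα₂, ← ha₁, ← ha₂, ← hs, ← hσ, ← hbdef, ← hcdef, hsσ, ← hθ] at h3
      simp only [Pi.mul_apply]
      rw [h1, cesUnitCost_smul hs0 hx.le h2, ← mul_assoc, ← ENNReal.ofReal_mul hx.le, h3,
        ENNReal.ofReal_mul (by positivity)]
      ring
    rw [setLIntegral_congr_fun measurableSet_Ioi hpt, lintegral_const_mul' _ _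
      ENNReal.ofReal_ne_top, lintegral_Ioi_one_sub_mul_rpow hc hH, hHc,
      ← ENNReal.ofReal_mul (by positivity), ← ENNReal.ofReal_mul (by positivity)]
    congr 1
    ring
  rw [setLIntegral_congr_fun measurableSet_Ioi hin, lintegral_const_mul' _ _
    ENNReal.ofReal_ne_top, lintegral_angular hb ha₁0 ha₂0 hp0 hp1 hσ0,
    ← ENNReal.ofReal_mul (by positivity)]
  congr 1
  have hK := capacityConst_mul (α₁ := α₁) (α₂ := α₂) hρ hγ₀ hγ₁
  rw [Real.mul_rpow hα₁.le hα₂.le, ← ha₁, ← ha₂, ← hs, hsσ, ← hbdef] at hK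
  rw [cesProfit, ← ha₁, ← ha₂, ← hσ, ← hcdef, ← hbdef]
  have hγc : γ ^ (1 / (1 - γ)) = γ * γ ^ c := by
    rw [show 1 / (1 - γ) = 1 + c by rw [hcdef]; field_simp; ring, Real.rpow_add hγ₀,
      Real.rpow_one]
  have hcc : c * (c + 1) = γ / (1 - γ) ^ 2 := by
    rw [hcdef]; field_simp; ring
  generalize (a₁ * p 0 ^ σ + a₂ * p 1 ^ σ) ^ (-b) = D
  rw [show capacityConst α₁ α₂ ρ γ / (c * (c + 1)) *
    (D * ProbabilityTheory.beta (b / 2 + 1 / 2) (1 / 2) / (2 * σ * a₁ * a₂)) =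
    (capacityConst α₁ α₂ ρ γ * ProbabilityTheory.beta (b / 2 + 1 / 2) (1 / 2)) * D /
      (c * (c + 1) * (2 * σ * a₁ * a₂)) by field_simp, hK, hγc, hcc]
  field_simp

end

end ResourceModel

/-! ### Unit cost duality for an arbitrary micro-level function. -/

namespace ResourceModel

open Set

lemma IsMicroFunction.map_zero {n : ℕ} {f : (Fin n → ℝ) → ℝ} (hf : IsMicroFunction f) :
    f 0 = 0 := by
  have := hf.homogeneous 2 two_pos 0 le_rfl
  rw [smul_zero] at this
  linarith

lemma IsMicroFunction.youngTransform_mul_le {n : ℕ} {f : (Fin n → ℝ) → ℝ} (hf : IsMicroFunction f)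
    {q v : Fin n → ℝ} (hq : 0 ≤ q) (hv : 0 ≤ v) :
    youngTransform f q * f v ≤ ∑ j, q j * v j := by
  rcases (hf.nonneg v hv).eq_or_lt with h | h
  · rw [← h, mul_zero]
    exact Finset.sum_nonneg fun j _ => mul_nonneg (hq j) (hv j)
  · rw [← le_div_iff₀ h]
    refine csInf_le ⟨0, ?_⟩ ⟨v, hv, h, rfl⟩
    rintro c ⟨w, hw, hfw, rfl⟩
    exact div_nonneg (Finset.sum_nonneg fun j _ => mul_nonneg (hq j) (hw j)) hfw.le

/-- At positive prices with positive unit cost the infimum in the Young transform is attained. -/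
lemma IsMicroFunction.exists_youngTransform_eq {n : ℕ} {f : (Fin n → ℝ) → ℝ}
    (hf : IsMicroFunction f) {q : Fin n → ℝ} (hq : ∀ j, 0 < q j) (hh : 0 < youngTransform f q) :
    ∃ v, 0 ≤ v ∧ f v = 1 ∧ ∑ j, q j * v j = youngTransform f q := by
  -- Were f zero on the orthant, the infimum would run over the empty set and take the default value
  -- 0, against `hh`.
  have hne : ∃ v, 0 ≤ v ∧ 0 < f v := by
    by_contra! hcon
    have : {c | ∃ v : Fin n → ℝ, 0 ≤ v ∧ 0 < f v ∧ c = (∑ j, q j * v j) / f v} = ∅ := by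
      ext c
      simp only [mem_ofPred_eq, mem_empty_iff_false, iff_false]
      rintro ⟨v, hv, hfv, -⟩
      exact absurd hfv (hcon v hv).not_gt
    rw [youngTransform, this, Real.sInf_empty] at hh
    exact lt_irrefl _ hh
  obtain ⟨v₀, hv₀, hfv₀⟩ := hne
  have hpos : ∀ v, 0 ≤ v → 0 < f v → 0 < ∑ j, q j * v j := by
    intro v hv hfv
    refine (Finset.sum_nonneg fun j _ => mul_nonneg (hq j).le (hv j)).lt_of_ne' fun h0 => ?_
    have h1 := (Finset.sum_eq_zero_iff_of_nonneg
      fun j _ => mul_nonneg (hq j).le (hv j)).1 h0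
    have : v = 0 := by
      ext j
      exact (mul_eq_zero.1 (h1 j (Finset.mem_univ j))).resolve_left (hq j).ne'
    rw [this, hf.map_zero] at hfv
    exact lt_irrefl _ hfv
  -- By homogeneity it suffices to maximize f over the bundles of cost 1, which form a compact set
  -- because all prices are positive.
  set K := {v : Fin n → ℝ | 0 ≤ v ∧ ∑ j, q j * v j = 1} with hK
  have hKc : IsCompact K := by
    refine IsCompact.of_isClosed_subset (isCompact_Icc (a := (0 : Fin n → ℝ))
      (b := fun j => 1 / q j)) ?_ ?_
    · exact (isClosed_Ici (a := (0 : Fin n → ℝ))).inter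
        (isClosed_eq (by fun_prop) continuous_const)
    · rintro v ⟨hv, hs⟩
      refine ⟨hv, fun j => ?_⟩
      rw [le_div_iff₀ (hq j), ← hs, mul_comm]
      exact Finset.single_le_sum (f := fun j => q j * v j)
        (fun i _ => mul_nonneg (hq i).le (hv i)) (Finset.mem_univ j)
  have hscale : ∀ v, 0 ≤ v → 0 < f v → (∑ j, q j * v j)⁻¹ • v ∈ K := by
    intro v hv hfv
    have h0 := hpos v hv hfv
    refine ⟨smul_nonneg (inv_pos.2 h0).le hv, ?_⟩
    simp only [Pi.smul_apply, smul_eq_mul]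
    simp_rw [mul_left_comm (q _)]
    rw [← Finset.mul_sum, inv_mul_cancel₀ h0.ne']
  obtain ⟨w, hw, hmax⟩ := hKc.exists_isMaxOn ⟨_, hscale v₀ hv₀ hfv₀⟩
    (hf.continuousOn.mono fun v hv => hv.1)
  have hle : ∀ v, 0 ≤ v → 0 < f v → f v / (∑ j, q j * v j) ≤ f w := by
    intro v hv hfv
    have h1 := hmax (hscale v hv hfv)
    simp only [mem_ofPred_eq] at h1
    rwa [hf.homogeneous _ (inv_pos.2 (hpos v hv hfv)) v hv, inv_mul_eq_div] at h1
  have hfw : 0 < f w := (div_pos hfv₀ (hpos v₀ hv₀ hfv₀)).trans_le (hle v₀ hv₀ hfv₀)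
  have hval : youngTransform f q = 1 / f w := by
    refine (IsLeast.csInf_eq ⟨⟨w, hw.1, hfw, by rw [hw.2]⟩, ?_⟩)
    rintro c ⟨v, hv, hfv, rfl⟩
    have h1 := hle v hv hfv
    have h2 := hpos v hv hfv
    rw [div_le_iff₀ h2] at h1
    rw [div_le_div_iff₀ hfw hfv]
    linarith
  refine ⟨(f w)⁻¹ • w, smul_nonneg (inv_pos.2 hfw).le hw.1, ?_, ?_⟩
  · rw [hf.homogeneous _ (inv_pos.2 hfw) w hw.1, inv_mul_cancel₀ hfw.ne']
  · simp only [Pi.smul_apply, smul_eq_mul]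
    simp_rw [mul_left_comm (q _)]
    rw [← Finset.mul_sum, hw.2, hval]
    ring

/-- The gradient of the CES unit cost. -/
noncomputable def cesCostGrad (s : ℝ) (q : Fin 2 → ℝ) : Fin 2 → ℝ :=
  fun j => (q 0 ^ s + q 1 ^ s) ^ (1 / s - 1) * q j ^ (s - 1)

lemma cesUnitCost_pos {s : ℝ} {q : Fin 2 → ℝ} (hq : ∀ j, 0 < q j) : 0 < cesUnitCost s q := by
  have h0 := hq 0
  have h1 := hq 1
  unfold cesUnitCost
  positivity

lemma cesCostGrad_nonneg {s : ℝ} {q : Fin 2 → ℝ} (hq : ∀ j, 0 < q j) : 0 ≤ cesCostGrad s q := by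
  have h0 := hq 0
  have h1 := hq 1
  intro j
  have := hq j
  simp only [cesCostGrad, Pi.zero_apply]
  positivity

/-- Euler's identity for a function homogeneous of degree one. -/
lemma sum_mul_cesCostGrad {s : ℝ} {q : Fin 2 → ℝ} (hq : ∀ j, 0 < q j) :
    ∑ j, q j * cesCostGrad s q j = cesUnitCost s q := by
  have h0 := hq 0
  have h1 := hq 1
  simp only [Fin.sum_univ_two, cesCostGrad, cesUnitCost]
  rw [Real.rpow_sub_one h0.ne', Real.rpow_sub_one h1.ne', Real.rpow_sub_one (by positivity)]
  field_simp

lemma hasDerivAt_cesUnitCost {s : ℝ} (hs : s ≠ 0) {q : Fin 2 → ℝ} (hq : ∀ j, 0 < q j) (j : Fin 2) :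
    HasDerivAt (fun t => cesUnitCost s (Function.update q j t)) (cesCostGrad s q j) (q j) := by
  have h0 := hq 0
  have h1 := hq 1
  have key : ∀ x y : ℝ, 0 < x → 0 < y →
      HasDerivAt (fun t => (t ^ s + y ^ s) ^ (1 / s))
        ((x ^ s + y ^ s) ^ (1 / s - 1) * x ^ (s - 1)) x := by
    intro x y hx hy
    have := ((Real.hasDerivAt_rpow_const (p := s) (Or.inl hx.ne')).add_const (y ^ s)).rpow_const
      (p := 1 / s) (Or.inl (by positivity : x ^ s + y ^ s ≠ 0))
    convert this using 1
    field_simp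
  fin_cases j
  · simpa [cesUnitCost, cesCostGrad] using key _ _ h0 h1
  · simpa [cesUnitCost, cesCostGrad, add_comm] using key _ _ h1 h0

lemma hasDerivAt_sum_update_mul {n : ℕ} (q v : Fin n → ℝ) (j : Fin n) :
    HasDerivAt (fun t => ∑ i, Function.update q j t i * v i) (v j) (q j) := by
  have : ∀ t, ∑ i, Function.update q j t i * v i = t * v j + ∑ i ∈ {j}ᶜ, q i * v i := by
    intro t
    rw [Fintype.sum_eq_add_sum_compl j, Function.update_self]
    congr 1
    refine Finset.sum_congr rfl fun i hi => ?_
    rw [Function.update_of_ne (by simpa using hi)]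
  simp_rw [this]
  simpa using ((hasDerivAt_id (q j)).mul_const (v j)).add_const (∑ i ∈ {j}ᶜ, q i * v i)

/-- A micro-level production function with CES unit cost takes the value one at the gradient of
the unit cost. -/
lemma IsMicroFunction.apply_cesCostGrad {f : (Fin 2 → ℝ) → ℝ} (hf : IsMicroFunction f) {s : ℝ}
    (hs : s ≠ 0) (hfs : ∀ q : Fin 2 → ℝ, 0 ≤ q → youngTransform f q = cesUnitCost s q)
    {q : Fin 2 → ℝ} (hq : ∀ j, 0 < q j) : f (cesCostGrad s q) = 1 := by
  have hq' : 0 ≤ q := fun j => (hq j).le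
  obtain ⟨v, hv, hfv, hsum⟩ := hf.exists_youngTransform_eq hq
    (by rw [hfs q hq']; exact cesUnitCost_pos hq)
  suffices v = cesCostGrad s q by rw [← this, hfv]
  ext j
  -- The cost-minimizing bundle v at q stays feasible at all other prices, so its linear cost
  -- dominates the unit cost and touches it at q; the partial derivatives agree there.
  have hmin : IsLocalMin (fun t => ∑ i, Function.update q j t i * v i -
      cesUnitCost s (Function.update q j t)) (q j) := by
    filter_upwards [lt_mem_nhds (hq j)] with t ht
    have ht' : 0 ≤ Function.update q j t := by
      rw [Pi.le_def]
      intro i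
      rcases eq_or_ne i j with rfl | h
      · simpa using ht.le
      · simpa [h] using (hq i).le
    have h1 := hf.youngTransform_mul_le ht' hv
    rw [hfs _ ht', hfv, mul_one] at h1
    rw [Function.update_eq_self, hsum, hfs q hq', sub_self]
    linarith
  have hd := hasDerivAt_sum_update_mul q v j
  have := hmin.hasDerivAt_eq_zero (hd.sub (hasDerivAt_cesUnitCost hs hq j))
  linarith

/-- Nothing is produced when one of the inputs is missing. -/
lemma IsMicroFunction.apply_eq_zero_of_coord_eq_zero {f : (Fin 2 → ℝ) → ℝ}
    (hf : IsMicroFunction f) {s : ℝ} (hs : 0 < s)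
    (hfs : ∀ q : Fin 2 → ℝ, 0 ≤ q → youngTransform f q = cesUnitCost s q)
    {v : Fin 2 → ℝ} (hv : 0 ≤ v) {j : Fin 2} (hj : v j = 0) : f v = 0 := by
  refine le_antisymm (le_of_forall_pos_le_add fun ε hε => ?_) (hf.nonneg v hv)
  set i : Fin 2 := 1 - j with hi
  set δ := ε / (v i + 1) with hδ
  have hvi : 0 ≤ v i := hv i
  -- Price 1 for the missing input keeps the unit cost at least 1, while price δ for the other makes
  -- the bundle cost less than ε.
  have hδ0 : 0 < δ := by positivity
  set q : Fin 2 → ℝ := fun k => if k = j then 1 else δ with hqdef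
  have hq : ∀ k, 0 < q k := fun k => by
    simp only [hqdef]; split_ifs <;> positivity
  have hq' : 0 ≤ q := fun k => (hq k).le
  have h1 := hf.youngTransform_mul_le hq' hv
  rw [hfs q hq'] at h1
  have hcost : 1 ≤ cesUnitCost s q := by
    have : 1 ≤ q 0 ^ s + q 1 ^ s := by
      have hδs : 0 < δ ^ s := by positivity
      fin_cases j <;> simp [hqdef] <;> linarith
    exact Real.one_le_rpow this (by positivity)
  have hsum : ∑ k, q k * v k = δ * v i := by
    rw [Fin.sum_univ_two]
    fin_cases j <;> simp_all
  have hfv := hf.nonneg v hv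
  calc f v ≤ cesUnitCost s q * f v := le_mul_of_one_le_left hfv hcost
    _ ≤ δ * v i := by rw [← hsum]; exact h1
    _ ≤ 0 + ε := by
      rw [hδ, zero_add, div_mul_eq_mul_div, div_le_iff₀ (by positivity)]
      nlinarith

end ResourceModel

/-! ### Existence of a micro-level function with CES unit cost. -/

namespace ResourceModel

open Set Filter Topology

/-- The integrand of the dual representation of the CES micro-level function: the cost of `v` at
the prices `(w ^ κ, (1 - w) ^ κ)`, whose unit cost is one for `κ = 1 / s`. -/
noncomputable def dualCost (κ : ℝ) (v : Fin 2 → ℝ) (w : ℝ) : ℝ :=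
  w ^ κ * v 0 + (1 - w) ^ κ * v 1

/-- The CES micro-level function, as the concave dual of the unit cost. -/
noncomputable def cesMicro (κ : ℝ) (v : Fin 2 → ℝ) : ℝ :=
  sInf (dualCost κ v '' Icc 0 1)

lemma dualCost_nonneg {κ : ℝ} {v : Fin 2 → ℝ} (hv : 0 ≤ v) {w : ℝ} (hw : w ∈ Icc (0 : ℝ) 1) :
    0 ≤ dualCost κ v w :=
  add_nonneg (mul_nonneg (Real.rpow_nonneg hw.1 _) (hv 0))
    (mul_nonneg (Real.rpow_nonneg (by linarith [hw.2]) _) (hv 1))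

lemma cesMicro_le {κ : ℝ} {v : Fin 2 → ℝ} (hv : 0 ≤ v) {w : ℝ} (hw : w ∈ Icc (0 : ℝ) 1) :
    cesMicro κ v ≤ dualCost κ v w :=
  csInf_le ⟨0, by rintro _ ⟨w, hw, rfl⟩; exact dualCost_nonneg hv hw⟩ ⟨w, hw, rfl⟩

lemma le_cesMicro {κ c : ℝ} {v : Fin 2 → ℝ} (h : ∀ w ∈ Icc (0 : ℝ) 1, c ≤ dualCost κ v w) :
    c ≤ cesMicro κ v :=
  le_csInf ((nonempty_Icc.2 zero_le_one).image _) (by rintro _ ⟨w, hw, rfl⟩; exact h w hw)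

/-- An infimum of nonnegative linear forms is homogeneous and concave; continuity comes from the
compactness of the parameter interval. -/
lemma isMicroFunction_cesMicro {κ : ℝ} (hκ : 0 ≤ κ) : IsMicroFunction (cesMicro κ) := by
  have hscale : ∀ t : ℝ, 0 < t → ∀ v : Fin 2 → ℝ, 0 ≤ v →
      t * cesMicro κ v ≤ cesMicro κ (t • v) := by
    refine fun t ht v hv => le_cesMicro fun w hw => ?_
    calc t * cesMicro κ v ≤ t * dualCost κ v w := by gcongr; exact cesMicro_le hv hw
      _ = dualCost κ (t • v) w := by simp only [dualCost, Pi.smul_apply, smul_eq_mul]; ring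
  refine ⟨fun v hv => le_cesMicro fun w hw => dualCost_nonneg hv hw, fun t ht v hv => ?_,
    ⟨convex_Ici 0, fun v hv w hw a b ha hb _ => ?_⟩, Continuous.continuousOn ?_⟩
  · refine le_antisymm ?_ (hscale t ht v hv)
    have h := hscale t⁻¹ (inv_pos.2 ht) (t • v) (smul_nonneg ht.le hv)
    rwa [smul_smul, inv_mul_cancel₀ ht.ne', one_smul, inv_mul_le_iff₀ ht] at h
  · refine le_cesMicro fun x hx => ?_
    calc a • cesMicro κ v + b • cesMicro κ w ≤ a * dualCost κ v x + b * dualCost κ w x := by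
          simp only [smul_eq_mul]
          gcongr
          · exact cesMicro_le hv hx
          · exact cesMicro_le hw hx
      _ = _ := by simp only [dualCost, Pi.smul_apply, Pi.add_apply, smul_eq_mul]; ring
  · refine isCompact_Icc.continuous_sInf (f := dualCost κ) ?_
    have hc := Real.continuous_rpow_const hκ
    have h1 : Continuous fun q : (Fin 2 → ℝ) × ℝ => q.2 ^ κ := hc.comp continuous_snd
    have h2 : Continuous fun q : (Fin 2 → ℝ) × ℝ => (1 - q.2) ^ κ :=
      hc.comp (continuous_const.sub continuous_snd)
    exact (h1.mul (by fun_prop)).add (h2.mul (by fun_prop))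

lemma cesUnitCost_nonneg {s : ℝ} {q : Fin 2 → ℝ} (hq : 0 ≤ q) : 0 ≤ cesUnitCost s q := by
  have h0 := hq 0
  have h1 := hq 1
  simp only [Pi.zero_apply] at h0 h1
  unfold cesUnitCost
  positivity

/-- Dividing q by its unit cost gives a price vector (w^(1/s), (1-w)^(1/s)), one of those over which
the infimum is taken. -/
lemma cesUnitCost_mul_cesMicro_le {s : ℝ} (hs : 0 < s) {q v : Fin 2 → ℝ} (hq : 0 ≤ q)
    (hv : 0 ≤ v) : cesUnitCost s q * cesMicro (1 / s) v ≤ ∑ j, q j * v j := by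
  have h0 : 0 ≤ q 0 := hq 0
  have h1 : 0 ≤ q 1 := hq 1
  have hA : 0 ≤ q 0 ^ s := by positivity
  have hB : 0 ≤ q 1 ^ s := by positivity
  rcases (add_nonneg hA hB).eq_or_lt with h | h
  · rw [cesUnitCost, ← h, Real.zero_rpow (by positivity), zero_mul]
    exact Finset.sum_nonneg fun j _ => mul_nonneg (hq j) (hv j)
  · have hw : q 0 ^ s / (q 0 ^ s + q 1 ^ s) ∈ Icc (0 : ℝ) 1 :=
      ⟨by positivity, by rw [div_le_one h]; linarith⟩
    have e : 1 - q 0 ^ s / (q 0 ^ s + q 1 ^ s) = q 1 ^ s / (q 0 ^ s + q 1 ^ s) := by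
      field_simp
      ring
    have hc : 0 < cesUnitCost s q := Real.rpow_pos_of_pos h _
    calc _ ≤ cesUnitCost s q * dualCost (1 / s) v _ := by gcongr; exact cesMicro_le hv hw
      _ = ∑ j, q j * v j := by
        rw [dualCost, e, Real.div_rpow hA h.le, Real.div_rpow hB h.le, ← Real.rpow_mul h0,
          ← Real.rpow_mul h1, mul_one_div_cancel hs.ne', Real.rpow_one, Real.rpow_one,
          ← cesUnitCost, Fin.sum_univ_two]
        field_simp

/-- A form of Hölder's inequality. -/
lemma one_le_cesMicro_cesCostGrad {s : ℝ} (hs₀ : 0 < s) (hs₁ : s < 1) {q : Fin 2 → ℝ}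
    (hq : ∀ j, 0 < q j) : 1 ≤ cesMicro (1 / s) (cesCostGrad s q) := by
  have h0 := hq 0
  have h1 := hq 1
  set S := q 0 ^ s + q 1 ^ s with hS
  have hS0 : 0 < S := by positivity
  have key : ∀ x w : ℝ, 0 < x → 0 ≤ w →
      x ^ s / S + 1 / s * (w - x ^ s / S) ≤ w ^ (1 / s) * (S ^ (1 / s - 1) * x ^ (s - 1)) := by
    intro x w hx hw
    set θ := x ^ s / S with hθ
    have hθ0 : 0 < θ := by positivity
    have e : S ^ (1 / s - 1) * x ^ (s - 1) = θ ^ (1 - 1 / s) := by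
      rw [hθ, Real.div_rpow (by positivity) hS0.le, ← Real.rpow_mul hx.le,
        show s * (1 - 1 / s) = s - 1 by field_simp, show 1 / s - 1 = -(1 - 1 / s) by ring,
        Real.rpow_neg hS0.le]
      ring
    -- Bernoulli's inequality at w/θ: the convex function w^(1/s) lies above its tangent at θ. This
    -- needs 1/s ≥ 1.
    have hB := one_add_mul_self_le_rpow_one_add (s := w / θ - 1) (p := 1 / s)
      (by have : 0 ≤ w / θ := by positivity
          linarith) (by rw [le_div_iff₀ hs₀]; linarith)
    rw [add_sub_cancel, Real.div_rpow hw hθ0.le] at hB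
    rw [e, Real.rpow_sub hθ0, Real.rpow_one]
    calc θ + 1 / s * (w - θ) = θ * (1 + 1 / s * (w / θ - 1)) := by field_simp
      _ ≤ θ * (w ^ (1 / s) / θ ^ (1 / s)) := by gcongr
      _ = _ := by ring
  refine le_cesMicro fun w hw => ?_
  have k0 := key _ w h0 hw.1
  have k1 := key _ (1 - w) h1 (by linarith [hw.2])
  have e : q 0 ^ s / S + q 1 ^ s / S = 1 := by rw [← add_div, div_self hS0.ne']
  simp only [dualCost, cesCostGrad, ← hS]
  -- The linear terms of the two tangent bounds cancel because both pairs of weights sum to 1.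
  have e2 : 1 / s * (w - q 0 ^ s / S) + 1 / s * (1 - w - q 1 ^ s / S) = 0 := by
    rw [← mul_add]
    exact mul_eq_zero_of_right _ (by linarith)
  linarith

lemma youngTransform_cesMicro {s : ℝ} (hs₀ : 0 < s) (hs₁ : s < 1) {q : Fin 2 → ℝ} (hq : 0 ≤ q) :
    youngTransform (cesMicro (1 / s)) q = cesUnitCost s q := by
  have hne : ∀ q : Fin 2 → ℝ, {c | ∃ v : Fin 2 → ℝ, 0 ≤ v ∧ 0 < cesMicro (1 / s) v ∧
      c = (∑ j, q j * v j) / cesMicro (1 / s) v}.Nonempty := fun q =>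
    ⟨_, cesCostGrad s 1, cesCostGrad_nonneg fun _ => one_pos,
      one_pos.trans_le (one_le_cesMicro_cesCostGrad hs₀ hs₁ fun _ => one_pos), rfl⟩
  have hbdd : ∀ q : Fin 2 → ℝ, 0 ≤ q → BddBelow {c | ∃ v : Fin 2 → ℝ, 0 ≤ v ∧
      0 < cesMicro (1 / s) v ∧ c = (∑ j, q j * v j) / cesMicro (1 / s) v} := by
    refine fun q hq => ⟨0, ?_⟩
    rintro c ⟨v, hv, hfv, rfl⟩
    exact div_nonneg (Finset.sum_nonneg fun j _ => mul_nonneg (hq j) (hv j)) hfv.le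
  have hle : ∀ q : Fin 2 → ℝ, (∀ j, 0 < q j) →
      youngTransform (cesMicro (1 / s)) q ≤ cesUnitCost s q := by
    intro q hq
    have h1 := one_le_cesMicro_cesCostGrad hs₀ hs₁ hq
    refine (csInf_le (hbdd q fun j => (hq j).le) ⟨cesCostGrad s q, cesCostGrad_nonneg hq,
      one_pos.trans_le h1, rfl⟩).trans ?_
    rw [sum_mul_cesCostGrad hq]
    exact div_le_self (cesUnitCost_pos hq).le h1
  apply le_antisymm
  -- The gradient is a competitor only at positive prices. Boundary prices are approached by q + ε:
  -- the Young transform is monotone in the prices and the CES cost is continuous.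
  · have hlim : Tendsto (fun ε : ℝ => cesUnitCost s fun j => q j + ε) (𝓝[>] 0)
        (𝓝 (cesUnitCost s q)) := by
      have hc := Real.continuous_rpow_const hs₀.le
      have hc' := Real.continuous_rpow_const (one_div_pos.2 hs₀).le
      have : Continuous fun ε : ℝ => cesUnitCost s fun j => q j + ε :=
        hc'.comp ((hc.comp (continuous_const.add continuous_id)).add
          (hc.comp (continuous_const.add continuous_id)))
      simpa using (this.tendsto 0).mono_left (nhdsWithin_le_nhds (s := Ioi 0))
    refine ge_of_tendsto hlim ?_
    filter_upwards [self_mem_nhdsWithin] with ε (hε : 0 < ε)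
    refine le_trans ?_ (hle _ fun j => add_pos_of_nonneg_of_pos (hq j) hε)
    refine le_csInf (hne _) ?_
    rintro c ⟨v, hv, hfv, rfl⟩
    refine (csInf_le (hbdd q hq) ⟨v, hv, hfv, rfl⟩).trans ?_
    gcongr with j
    · exact hv j
    · linarith
  · refine le_csInf (hne q) ?_
    rintro c ⟨v, hv, hfv, rfl⟩
    rw [le_div_iff₀ hfv]
    exact cesUnitCost_mul_cesMicro_le hs₀ hq hv

end ResourceModel

/-! ### Duality between output and profit. -/

namespace ResourceModel

open Set Filter Topology

/-- For h ≤ 1, split min(1, y) with weights 1 - h and h and bound it by 1 and by y respectively; for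
h ≥ 1, already y ≤ hy. -/
lemma ofReal_min_le_of_mul_le {h y c : ℝ} (hh : 0 ≤ h) (hy : 0 ≤ y) (hc : h * y ≤ c) :
    ENNReal.ofReal (min 1 y) ≤ ENNReal.ofReal (1 - h) + ENNReal.ofReal c := by
  rcases le_total h 1 with h1 | h1
  · rw [← ENNReal.ofReal_add (by linarith) ((mul_nonneg hh hy).trans hc)]
    refine ENNReal.ofReal_le_ofReal ?_
    nlinarith [min_le_left 1 y, mul_le_mul_of_nonneg_left (min_le_right 1 y) hh]
  · refine le_add_left (ENNReal.ofReal_le_ofReal ((min_le_right _ _).trans ?_))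
    nlinarith

section

variable {f : (Fin 2 → ℝ) → ℝ} {s : ℝ} {μ : Measure (Fin 2 → ℝ)}

/-- Weak duality: output is at most profit plus the cost of the resources. -/
lemma totalOutput_le (hf : IsMicroFunction f)
    (hfs : ∀ q : Fin 2 → ℝ, 0 ≤ q → youngTransform f q = cesUnitCost s q)
    (hμ : ∀ᵐ x ∂μ, ∀ j, 0 < x j) {l p : Fin 2 → ℝ} (hp : ∀ j, 0 < p j)
    {u : (Fin 2 → ℝ) → Fin 2 → ℝ} (hu : IsAdmissible μ l u) :
    totalOutput f μ u ≤ ∫⁻ x, ENNReal.ofReal (1 - cesUnitCost s (p * x)) ∂μ +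
      ENNReal.ofReal (∑ j, p j * l j) := by
  have hmeas : Measurable fun x : Fin 2 → ℝ => ENNReal.ofReal (1 - cesUnitCost s (p * x)) :=
    (measurable_const.sub ((measurable_cesUnitCost s).comp (by fun_prop))).ennreal_ofReal
  have hint : Integrable (fun x => ∑ j, p j * u x j) μ :=
    integrable_finsetSum _ fun j _ => (hu.integrable j).const_mul (p j)
  have hnn : 0 ≤ᵐ[μ] fun x => ∑ j, p j * u x j := by
    filter_upwards [hu.nonneg] with x hx
    exact Finset.sum_nonneg fun j _ => mul_nonneg (hp j).le (hx j)
  calc totalOutput f μ u ≤ ∫⁻ x, (ENNReal.ofReal (1 - cesUnitCost s (p * x)) +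
        ENNReal.ofReal (∑ j, p j * u x j)) ∂μ := by
        refine lintegral_mono_ae ?_
        filter_upwards [hμ, hu.nonneg] with x hx hux
        have hv : (0 : Fin 2 → ℝ) ≤ fun j => u x j / x j := fun j =>
          div_nonneg (hux j) (hx j).le
        have hq : 0 ≤ p * x := fun j => (mul_pos (hp j) (hx j)).le
        have h1 := hf.youngTransform_mul_le hq hv
        rw [hfs _ hq] at h1
        refine ofReal_min_le_of_mul_le (cesUnitCost_nonneg hq) (hf.nonneg _ hv)
          (h1.trans_eq (Finset.sum_congr rfl fun j _ => ?_))
        have := (hx j).ne'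
        simp only [Pi.mul_apply]
        field_simp
    _ = ∫⁻ x, ENNReal.ofReal (1 - cesUnitCost s (p * x)) ∂μ +
        ENNReal.ofReal (∑ j, p j * ∫ x, u x j ∂μ) := by
        rw [lintegral_add_left hmeas, ← ofReal_integral_eq_lintegral_ofReal hint hnn,
          integral_finsetSum _ fun j _ => (hu.integrable j).const_mul (p j)]
        simp_rw [integral_const_mul]
    _ ≤ _ := by
        gcongr with j
        · exact (hp j).le
        · exact hu.integral_le j

/-- The input plan that is optimal at prices `p`: the technologies with unit cost at most one work
at full capacity with the cheapest inputs. -/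
noncomputable def optimalPlan (s : ℝ) (p x : Fin 2 → ℝ) : Fin 2 → ℝ :=
  if cesUnitCost s (p * x) ≤ 1 then x * cesCostGrad s (p * x) else 0

lemma measurable_optimalPlan (s : ℝ) (p : Fin 2 → ℝ) (j : Fin 2) :
    Measurable fun x => optimalPlan s p x j := by
  have h1 : Measurable fun x : Fin 2 → ℝ => cesUnitCost s (p * x) :=
    (measurable_cesUnitCost s).comp (by fun_prop)
  have h2 : Measurable fun x : Fin 2 → ℝ => x j * cesCostGrad s (p * x) j := by
    simp only [cesCostGrad, Pi.mul_apply]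
    fun_prop
  have : (fun x => optimalPlan s p x j) = fun x =>
      if cesUnitCost s (p * x) ≤ 1 then x j * cesCostGrad s (p * x) j else 0 := by
    ext x
    unfold optimalPlan
    split_ifs <;> rfl
  rw [this]
  exact Measurable.ite (measurableSet_le h1 measurable_const) h2 measurable_const

lemma optimalPlan_nonneg {p x : Fin 2 → ℝ} (hp : ∀ j, 0 < p j) (hx : ∀ j, 0 < x j) :
    0 ≤ optimalPlan s p x := by
  unfold optimalPlan
  split_ifs
  · exact mul_nonneg (fun j => (hx j).le) (cesCostGrad_nonneg fun j => mul_pos (hp j) (hx j))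
  · exact le_rfl

lemma sum_mul_optimalPlan {p x : Fin 2 → ℝ} (hp : ∀ j, 0 < p j) (hx : ∀ j, 0 < x j) :
    ∑ j, p j * optimalPlan s p x j =
      if cesUnitCost s (p * x) ≤ 1 then cesUnitCost s (p * x) else 0 := by
  rw [← sum_mul_cesCostGrad (q := p * x) fun j => mul_pos (hp j) (hx j)]
  simp only [optimalPlan, sum_mul_cesCostGrad (q := p * x) fun j => mul_pos (hp j) (hx j)]
  split_ifs
  · rw [← sum_mul_cesCostGrad (q := p * x) fun j => mul_pos (hp j) (hx j)]
    exact Finset.sum_congr rfl fun j _ => by simp only [Pi.mul_apply]; ring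
  · simp

lemma apply_optimalPlan (hf : IsMicroFunction f) (hs : 0 < s)
    (hfs : ∀ q : Fin 2 → ℝ, 0 ≤ q → youngTransform f q = cesUnitCost s q)
    {p x : Fin 2 → ℝ} (hp : ∀ j, 0 < p j) (hx : ∀ j, 0 < x j) :
    f (fun j => optimalPlan s p x j / x j) = if cesUnitCost s (p * x) ≤ 1 then 1 else 0 := by
  unfold optimalPlan
  split_ifs
  · rw [← hf.apply_cesCostGrad hs.ne' hfs (q := p * x) fun j => mul_pos (hp j) (hx j)]
    congr 1
    ext j
    have := (hx j).ne'
    simp only [Pi.mul_apply]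
    field_simp
  · rw [← hf.map_zero]
    congr 1
    ext j
    simp

/-- Weak duality is an equality pointwise: an active technology gives 1 = (1 - h) + h, an idle one 0
= 0 + 0. -/
lemma totalOutput_optimalPlan (hf : IsMicroFunction f) (hs : 0 < s)
    (hfs : ∀ q : Fin 2 → ℝ, 0 ≤ q → youngTransform f q = cesUnitCost s q)
    (hμ : ∀ᵐ x ∂μ, ∀ j, 0 < x j) {p : Fin 2 → ℝ} (hp : ∀ j, 0 < p j) :
    totalOutput f μ (optimalPlan s p) =
      ∫⁻ x, ENNReal.ofReal (1 - cesUnitCost s (p * x)) ∂μ +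
        ∫⁻ x, ENNReal.ofReal (∑ j, p j * optimalPlan s p x j) ∂μ := by
  have hmeas : Measurable fun x : Fin 2 → ℝ => ENNReal.ofReal (1 - cesUnitCost s (p * x)) :=
    (measurable_const.sub ((measurable_cesUnitCost s).comp (by fun_prop))).ennreal_ofReal
  rw [← lintegral_add_left hmeas]
  refine lintegral_congr_ae ?_
  filter_upwards [hμ] with x hx
  rw [apply_optimalPlan hf hs hfs hp hx, sum_mul_optimalPlan hp hx]
  have hc := (cesUnitCost_pos (s := s) (q := p * x) fun j => mul_pos (hp j) (hx j)).le
  split_ifs with h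
  · rw [← ENNReal.ofReal_add (by linarith) hc]
    norm_num
  · simp [(not_le.1 h).le]

/-- Where h(p∘x) ≤ 1, spending is at most 1 ≤ 2(1 - h(p∘x/2)), so finite profit at the halved prices
bounds the inputs. -/
lemma integrable_optimalPlan (hs : 0 < s) (hμ : ∀ᵐ x ∂μ, ∀ j, 0 < x j) {p : Fin 2 → ℝ}
    (hp : ∀ j, 0 < p j)
    (hfin : ∫⁻ x, ENNReal.ofReal (1 - cesUnitCost s ((2⁻¹ : ℝ) • p * x)) ∂μ ≠ ∞) (j : Fin 2) :
    Integrable (fun x => optimalPlan s p x j) μ := by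
  refine ⟨(measurable_optimalPlan s p j).aestronglyMeasurable, ?_⟩
  rw [hasFiniteIntegral_iff_ofReal (by
    filter_upwards [hμ] with x hx using optimalPlan_nonneg hp hx j)]
  refine lt_of_le_of_lt (lintegral_mono_ae (g := fun x => ENNReal.ofReal (2 / p j) *
    ENNReal.ofReal (1 - cesUnitCost s ((2⁻¹ : ℝ) • p * x))) ?_) ?_
  · filter_upwards [hμ] with x hx
    have hpj := hp j
    rw [← ENNReal.ofReal_mul (by positivity)]
    by_cases h : cesUnitCost s (p * x) ≤ 1
    · refine ENNReal.ofReal_le_ofReal ?_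
      have h1 := sum_mul_optimalPlan (s := s) hp hx
      rw [if_pos h] at h1
      have h2 : p j * optimalPlan s p x j ≤ ∑ i, p i * optimalPlan s p x i :=
        Finset.single_le_sum (f := fun i => p i * optimalPlan s p x i)
          (fun i _ => mul_nonneg (hp i).le (optimalPlan_nonneg hp hx i)) (Finset.mem_univ j)
      rw [smul_mul_assoc, cesUnitCost_smul hs (by norm_num)
        (show 0 ≤ p * x from fun i => (mul_pos (hp i) (hx i)).le),
        div_mul_eq_mul_div, le_div_iff₀ hpj]
      linarith
    · rw [optimalPlan, if_neg h]
      simp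
  · rw [lintegral_const_mul' _ _ ENNReal.ofReal_ne_top]
    exact ENNReal.mul_lt_top ENNReal.ofReal_lt_top hfin.lt_top

/-- Duality: if the resources `l` are minus the gradient of the profit function at the prices `p`,
then the maximal output is profit plus cost of the resources. -/
lemma isGreatest_totalOutput (hf : IsMicroFunction f) (hs : 0 < s)
    (hfs : ∀ q : Fin 2 → ℝ, 0 ≤ q → youngTransform f q = cesUnitCost s q)
    (hμ : ∀ᵐ x ∂μ, ∀ j, 0 < x j) {P : (Fin 2 → ℝ) → ℝ}
    (hP : ∀ p : Fin 2 → ℝ, (∀ j, 0 < p j) → 0 ≤ P p ∧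
      ∫⁻ x, ENNReal.ofReal (1 - cesUnitCost s (p * x)) ∂μ = ENNReal.ofReal (P p))
    {l p : Fin 2 → ℝ} (hl : 0 ≤ l) (hp : ∀ j, 0 < p j)
    (hder : ∀ j, HasDerivAt (fun t => P (Function.update p j t)) (-l j) (p j)) :
    IsGreatest {y | ∃ u, IsAdmissible μ l u ∧ y = totalOutput f μ u}
      (ENNReal.ofReal (P p + ∑ j, p j * l j)) := by
  have hint : ∀ j, Integrable (fun x => optimalPlan s p x j) μ :=
    integrable_optimalPlan hs hμ hp (by
      rw [(hP _ fun j => by have := hp j; simp only [Pi.smul_apply, smul_eq_mul]; positivity).2]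
      exact ENNReal.ofReal_ne_top)
  have hnn : ∀ᵐ x ∂μ, 0 ≤ optimalPlan s p x := by
    filter_upwards [hμ] with x hx using optimalPlan_nonneg hp hx
  set U : Fin 2 → ℝ := fun j => ∫ x, optimalPlan s p x j ∂μ with hU
  have hU0 : 0 ≤ U := fun j => integral_nonneg_of_ae (by filter_upwards [hnn] with x hx using hx j)
  have hcost : ∀ p' : Fin 2 → ℝ, (∀ j, 0 < p' j) → 0 ≤ ∑ j, p' j * U j := fun p' hp' =>
    Finset.sum_nonneg fun j _ => mul_nonneg (hp' j).le (hU0 j)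
  have hadm : IsAdmissible μ U (optimalPlan s p) := ⟨hnn, hint, fun j => le_rfl⟩
  have hout : totalOutput f μ (optimalPlan s p) = ENNReal.ofReal (P p + ∑ j, p j * U j) := by
    rw [totalOutput_optimalPlan hf hs hfs hμ hp, (hP p hp).2,
      ENNReal.ofReal_add (hP p hp).1 (hcost p hp),
      ← ofReal_integral_eq_lintegral_ofReal
        (integrable_finsetSum _ fun j _ => (hint j).const_mul (p j)),
      integral_finsetSum _ fun j _ => (hint j).const_mul (p j)]
    · simp_rw [integral_const_mul, hU]
    · filter_upwards [hnn] with x hx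
      exact Finset.sum_nonneg fun j _ => mul_nonneg (hp j).le (hx j)
  -- The plan is admissible for its own usage U; weak duality at p' bounds its output, which equals
  -- the dual value at p.
  have hmin : ∀ p' : Fin 2 → ℝ, (∀ j, 0 < p' j) →
      P p + ∑ j, p j * U j ≤ P p' + ∑ j, p' j * U j := by
    intro p' hp'
    have h := totalOutput_le hf hfs hμ hp' hadm
    rw [hout, (hP p' hp').2, ← ENNReal.ofReal_add (hP p' hp').1 (hcost p' hp')] at h
    exact (ENNReal.ofReal_le_ofReal_iff (add_nonneg (hP p' hp').1 (hcost p' hp'))).1 h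
  have hUl : U = l := by
    ext j
    have hloc : IsLocalMin (fun t => P (Function.update p j t) +
        ∑ i, Function.update p j t i * U i) (p j) := by
      filter_upwards [lt_mem_nhds (hp j)] with t ht
      simp only [Function.update_eq_self]
      refine hmin _ fun i => ?_
      rcases eq_or_ne i j with rfl | h
      · simpa using ht
      · simpa [h] using hp i
    have := hloc.hasDerivAt_eq_zero ((hder j).add (hasDerivAt_sum_update_mul p U j))
    linarith
  constructor
  · exact ⟨optimalPlan s p, hUl ▸ hadm, by rw [hout, hUl]⟩
  · rintro y ⟨u, hu, rfl⟩
    have h := totalOutput_le hf hfs hμ hp hu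
    rwa [(hP p hp).2, ← ENNReal.ofReal_add (hP p hp).1
      (Finset.sum_nonneg fun j _ => mul_nonneg (hp j).le (hl j))] at h

/-- Nothing is produced when one of the resources is missing. -/
lemma isGreatest_totalOutput_zero (hf : IsMicroFunction f) (hs : 0 < s)
    (hfs : ∀ q : Fin 2 → ℝ, 0 ≤ q → youngTransform f q = cesUnitCost s q)
    (hμ : ∀ᵐ x ∂μ, ∀ j, 0 < x j) {l : Fin 2 → ℝ} (hl : 0 ≤ l) {j : Fin 2} (hj : l j = 0) :
    IsGreatest {y | ∃ u, IsAdmissible μ l u ∧ y = totalOutput f μ u} 0 := by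
  have key : ∀ u, IsAdmissible μ l u → totalOutput f μ u = 0 := by
    intro u hu
    have hnn : 0 ≤ᵐ[μ] fun x => u x j := by
      filter_upwards [hu.nonneg] with x hx using hx j
    have h0 : ∫ x, u x j ∂μ = 0 :=
      le_antisymm ((hu.integral_le j).trans_eq hj) (integral_nonneg_of_ae hnn)
    rw [integral_eq_zero_iff_of_nonneg_ae hnn (hu.integrable j)] at h0
    refine (lintegral_congr_ae ?_).trans lintegral_zero
    filter_upwards [hμ, hu.nonneg, h0] with x hx hux hx0
    simp only [Pi.zero_apply] at hx0
    rw [hf.apply_eq_zero_of_coord_eq_zero hs hfs (v := fun i => u x i / x i)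
      (fun i => div_nonneg (hux i) (hx i).le) (j := j) (by simp [hx0])]
    simp
  have hadm : IsAdmissible μ l 0 :=
    ⟨by simp, fun j => integrable_zero _ _ _, fun j => by simpa using hl j⟩
  exact ⟨⟨0, hadm, (key 0 hadm).symm⟩, by rintro y ⟨u, hu, rfl⟩; exact (key u hu).le⟩

end

end ResourceModel

/-! ### Conjugacy of the CES production and profit functions. -/

namespace ResourceModel

section

variable {α₁ α₂ ρ γ : ℝ}

lemma ae_capacityMeasure_pos : ∀ᵐ x ∂capacityMeasure α₁ α₂ ρ γ, ∀ j, 0 < x j :=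
  (withDensity_absolutelyContinuous _ _).ae_le (ae_restrict_mem measurableSet_quadrant)

lemma cesProfit_nonneg (hγ₀ : 0 < γ) (hγ₁ : γ < 1) (hα₁ : 0 < α₁) (hα₂ : 0 < α₂)
    {p : Fin 2 → ℝ} (hp : ∀ j, 0 < p j) : 0 ≤ cesProfit α₁ α₂ ρ γ p := by
  have h0 := hp 0
  have h1 := hp 1
  have : 0 < 1 - γ := by linarith
  unfold cesProfit
  positivity

/-- The prices at which the resources `l` are demanded, the gradient of the CES production
function. -/
noncomputable def cesPrice (α₁ α₂ ρ γ : ℝ) (l : Fin 2 → ℝ) : Fin 2 → ℝ := fun j =>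
  γ * ![α₁, α₂] j * l j ^ (-ρ - 1) * (α₁ * l 0 ^ (-ρ) + α₂ * l 1 ^ (-ρ)) ^ (-γ / ρ - 1)

lemma cesPrice_pos (hγ₀ : 0 < γ) (hα₁ : 0 < α₁) (hα₂ : 0 < α₂) {l : Fin 2 → ℝ}
    (hl : ∀ j, 0 < l j) (j : Fin 2) : 0 < cesPrice α₁ α₂ ρ γ l j := by
  have h0 := hl 0
  have h1 := hl 1
  unfold cesPrice
  fin_cases j <;> simp <;> positivity

/-- The cost aggregate at the prices `cesPrice`, one resource. -/
lemma rpow_mul_cesPrice_rpow (hρ : 0 < ρ) (hγ₀ : 0 < γ) {α l S : ℝ} (hα : 0 < α) (hl : 0 < l)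
    (hS : 0 < S) :
    α ^ (1 / (1 + ρ)) * (γ * α * l ^ (-ρ - 1) * S ^ (-γ / ρ - 1)) ^ (ρ / (1 + ρ)) =
      γ ^ (ρ / (1 + ρ)) * S ^ ((-γ / ρ - 1) * (ρ / (1 + ρ))) * (α * l ^ (-ρ)) := by
  rw [Real.mul_rpow (by positivity) (by positivity), Real.mul_rpow (by positivity) (by positivity),
    Real.mul_rpow (by positivity) (by positivity), ← Real.rpow_mul hl.le, ← Real.rpow_mul hS.le,
    show (-ρ - 1) * (ρ / (1 + ρ)) = -ρ by field_simp; ring]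
  have : α ^ (1 / (1 + ρ)) * α ^ (ρ / (1 + ρ)) = α := by
    rw [← Real.rpow_add hα, show 1 / (1 + ρ) + ρ / (1 + ρ) = 1 by field_simp, Real.rpow_one]
  linear_combination γ ^ (ρ / (1 + ρ)) * l ^ (-ρ) * S ^ ((-γ / ρ - 1) * (ρ / (1 + ρ))) * this

/-- At p = ∇F(l) each term of the price aggregate is a common factor times α_j l_j^(-ρ), so the
aggregate is a power of the CES sum of l. -/
lemma aggregate_cesPrice (hρ : 0 < ρ) (hγ₀ : 0 < γ) (hα₁ : 0 < α₁) (hα₂ : 0 < α₂)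
    {l : Fin 2 → ℝ} (hl : ∀ j, 0 < l j) :
    α₁ ^ (1 / (1 + ρ)) * cesPrice α₁ α₂ ρ γ l 0 ^ (ρ / (1 + ρ)) +
      α₂ ^ (1 / (1 + ρ)) * cesPrice α₁ α₂ ρ γ l 1 ^ (ρ / (1 + ρ)) =
      γ ^ (ρ / (1 + ρ)) * (α₁ * l 0 ^ (-ρ) + α₂ * l 1 ^ (-ρ)) ^ ((1 - γ) / (1 + ρ)) := by
  have h0 := hl 0
  have h1 := hl 1
  have hS : 0 < α₁ * l 0 ^ (-ρ) + α₂ * l 1 ^ (-ρ) := by positivity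
  simp only [cesPrice, Matrix.cons_val_zero, Matrix.cons_val_one]
  rw [rpow_mul_cesPrice_rpow hρ hγ₀ hα₁ h0 hS, rpow_mul_cesPrice_rpow hρ hγ₀ hα₂ h1 hS,
    ← mul_add, mul_assoc,
    show (1 - γ) / (1 + ρ) = (-γ / ρ - 1) * (ρ / (1 + ρ)) + 1 by field_simp; ring,
    Real.rpow_add hS, Real.rpow_one]

/-- F is homogeneous of degree γ, so the cost p·l is γF by Euler; the profit is the remaining
(1-γ)F. -/
lemma cesProfit_add_cost (hρ : 0 < ρ) (hγ₀ : 0 < γ) (hγ₁ : γ < 1) (hα₁ : 0 < α₁) (hα₂ : 0 < α₂)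
    {l : Fin 2 → ℝ} (hl : ∀ j, 0 < l j) :
    cesProfit α₁ α₂ ρ γ (cesPrice α₁ α₂ ρ γ l) + ∑ j, cesPrice α₁ α₂ ρ γ l j * l j =
      cesProduction α₁ α₂ ρ γ l := by
  have h0 := hl 0
  have h1 := hl 1
  have hγ' : 0 < 1 - γ := by linarith
  have hS : 0 < α₁ * l 0 ^ (-ρ) + α₂ * l 1 ^ (-ρ) := by positivity
  rw [cesProduction, if_pos ⟨h0, h1⟩, cesProfit, aggregate_cesPrice hρ hγ₀ hα₁ hα₂ hl,
    Real.mul_rpow (by positivity) (by positivity), ← Real.rpow_mul hγ₀.le, ← Real.rpow_mul hS.le,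
    show ρ / (1 + ρ) * -expB ρ γ = -(γ / (1 - γ)) by unfold expB; field_simp,
    show (1 - γ) / (1 + ρ) * -expB ρ γ = -γ / ρ by unfold expB; field_simp,
    Real.rpow_neg hγ₀.le, Fin.sum_univ_two]
  simp only [cesPrice, Matrix.cons_val_zero, Matrix.cons_val_one]
  rw [Real.rpow_sub_one h0.ne', Real.rpow_sub_one h1.ne', Real.rpow_sub_one hS.ne']
  have hg : 0 < γ ^ (γ / (1 - γ)) := by positivity
  generalize (α₁ * l 0 ^ (-ρ) + α₂ * l 1 ^ (-ρ)) ^ (-γ / ρ) = F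
  generalize γ ^ (γ / (1 - γ)) = G at *
  generalize l 0 ^ (-ρ) = A at *
  generalize l 1 ^ (-ρ) = B at *
  field_simp
  ring

/-- The derivative of the CES profit function in one price. -/
lemma hasDerivAt_profit_price {a k σ b x y : ℝ} (ha : 0 < a) (hx : 0 < x) (hy : 0 ≤ y) :
    HasDerivAt (fun t => k * (a * t ^ σ + y) ^ (-b))
      (-(k * b * σ * (a * x ^ σ + y) ^ (-b - 1) * (a * x ^ σ / x))) x := by
  have h := ((((Real.hasDerivAt_rpow_const (p := σ) (Or.inl hx.ne')).const_mul a).add_const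
    y).rpow_const (p := -b) (Or.inl (by positivity : a * x ^ σ + y ≠ 0))).const_mul k
  convert! h using 1
  rw [Real.rpow_sub_one hx.ne']
  ring

lemma hasDerivAt_cesProfit (hρ : 0 < ρ) (hγ₀ : 0 < γ) (hγ₁ : γ < 1) (hα₁ : 0 < α₁) (hα₂ : 0 < α₂)
    {l : Fin 2 → ℝ} (hl : ∀ j, 0 < l j) (j : Fin 2) :
    HasDerivAt (fun t => cesProfit α₁ α₂ ρ γ (Function.update (cesPrice α₁ α₂ ρ γ l) j t))
      (-l j) (cesPrice α₁ α₂ ρ γ l j) := by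
  have h0 := hl 0
  have h1 := hl 1
  have hp := cesPrice_pos (ρ := ρ) hγ₀ hα₁ hα₂ hl
  have hp0 := hp 0
  have hp1 := hp 1
  have hγ' : 0 < 1 - γ := by linarith
  have hS : 0 < α₁ * l 0 ^ (-ρ) + α₂ * l 1 ^ (-ρ) := by positivity
  have hagg := aggregate_cesPrice hρ hγ₀ hα₁ hα₂ hl
  -- Minus the derivative of the profit in one price, with the aggregate inserted. The powers of γ
  -- and of the CES sum S cancel, leaving the resource; one computation serves both coordinates.
  have key : ∀ α l' : ℝ, 0 < α → 0 < l' →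
      (1 - γ) * γ ^ (γ / (1 - γ)) * expB ρ γ * (ρ / (1 + ρ)) *
        (γ ^ (ρ / (1 + ρ)) *
          (α₁ * l 0 ^ (-ρ) + α₂ * l 1 ^ (-ρ)) ^ ((1 - γ) / (1 + ρ))) ^ (-expB ρ γ - 1) *
        (α ^ (1 / (1 + ρ)) * (γ * α * l' ^ (-ρ - 1) *
          (α₁ * l 0 ^ (-ρ) + α₂ * l 1 ^ (-ρ)) ^ (-γ / ρ - 1)) ^ (ρ / (1 + ρ)) /
          (γ * α * l' ^ (-ρ - 1) *
          (α₁ * l 0 ^ (-ρ) + α₂ * l 1 ^ (-ρ)) ^ (-γ / ρ - 1))) = l' := by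
    intro α l' hα hl'
    rw [rpow_mul_cesPrice_rpow hρ hγ₀ hα hl' hS]
    generalize α₁ * l 0 ^ (-ρ) + α₂ * l 1 ^ (-ρ) = S at *
    rw [Real.mul_rpow (by positivity) (by positivity), ← Real.rpow_mul hγ₀.le,
      ← Real.rpow_mul hS.le, Real.rpow_sub_one hl'.ne']
    have e1 : (1 - γ) * expB ρ γ * (ρ / (1 + ρ)) = γ := by unfold expB; field_simp
    have e2 : γ ^ (γ / (1 - γ)) * γ ^ (ρ / (1 + ρ) * (-expB ρ γ - 1)) * γ ^ (ρ / (1 + ρ)) = 1 := by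
      rw [← Real.rpow_add hγ₀, ← Real.rpow_add hγ₀]
      convert Real.rpow_zero γ using 2
      unfold expB
      field_simp
      ring
    have e3 : S ^ ((1 - γ) / (1 + ρ) * (-expB ρ γ - 1)) * S ^ ((-γ / ρ - 1) * (ρ / (1 + ρ))) =
        S ^ (-γ / ρ - 1) := by
      rw [← Real.rpow_add hS]
      congr 1
      unfold expB
      field_simp
      ring
    have hT : 0 < S ^ (-γ / ρ - 1) := by positivity
    have hL : 0 < l' ^ (-ρ) := by positivity
    calc _ = ((1 - γ) * expB ρ γ * (ρ / (1 + ρ))) *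
          (γ ^ (γ / (1 - γ)) * γ ^ (ρ / (1 + ρ) * (-expB ρ γ - 1)) * γ ^ (ρ / (1 + ρ))) *
          (S ^ ((1 - γ) / (1 + ρ) * (-expB ρ γ - 1)) * S ^ ((-γ / ρ - 1) * (ρ / (1 + ρ)))) *
          (α * l' ^ (-ρ)) / (γ * α * (l' ^ (-ρ) / l') * S ^ (-γ / ρ - 1)) := by ring
      _ = l' := by
        rw [e1, e2, e3]
        field_simp
  fin_cases j
  · have h := hasDerivAt_profit_price (a := α₁ ^ (1 / (1 + ρ)))
      (k := (1 - γ) * γ ^ (γ / (1 - γ))) (σ := ρ / (1 + ρ)) (b := expB ρ γ)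
      (y := α₂ ^ (1 / (1 + ρ)) * cesPrice α₁ α₂ ρ γ l 1 ^ (ρ / (1 + ρ)))
      (by positivity) hp0 (by positivity)
    rw [hagg] at h
    convert! h using 1
    exact congrArg Neg.neg (key α₁ (l 0) hα₁ h0).symm
  · have h := hasDerivAt_profit_price (a := α₂ ^ (1 / (1 + ρ)))
      (k := (1 - γ) * γ ^ (γ / (1 - γ))) (σ := ρ / (1 + ρ)) (b := expB ρ γ)
      (y := α₁ ^ (1 / (1 + ρ)) * cesPrice α₁ α₂ ρ γ l 0 ^ (ρ / (1 + ρ)))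
      (by positivity) hp1 (by positivity)
    rw [add_comm (α₂ ^ (1 / (1 + ρ)) * _), hagg] at h
    convert! h using 1
    · ext t
      simp only [cesProfit]
      rw [add_comm (α₂ ^ (1 / (1 + ρ)) * _)]
      rfl
    · exact congrArg Neg.neg (key α₂ (l 1) hα₂ h1).symm

end

end ResourceModel

/-! ### The main theorem. -/

theorem mainTheorem11 (ρ γ α₁ α₂ : ℝ) (hρ₀ : 0 < ρ) (hρ₁ : ρ < 1) (hγ₀ : 0 < γ) (hγ₁ : γ < 1)
    (hα₁ : 0 < α₁) (hα₂ : 0 < α₂) :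
    (∃ f : (Fin 2 → ℝ) → ℝ, ResourceModel.IsMicroFunction f ∧
      ∀ p x : Fin 2 → ℝ, 0 ≤ p → 0 ≤ x →
        ResourceModel.youngTransform f (p * x) =
          ResourceModel.cesUnitCost (2 * ρ / (1 + ρ)) (p * x)) ∧
    ∀ f : (Fin 2 → ℝ) → ℝ, ResourceModel.IsMicroFunction f →
      (∀ p x : Fin 2 → ℝ, 0 ≤ p → 0 ≤ x →
        ResourceModel.youngTransform f (p * x) =
          ResourceModel.cesUnitCost (2 * ρ / (1 + ρ)) (p * x)) →
      ResourceModel.IsProductionFunction f (ResourceModel.capacityMeasure α₁ α₂ ρ γ)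
        (fun l => ENNReal.ofReal (ResourceModel.cesProduction α₁ α₂ ρ γ l)) := by
  have hs₀ : 0 < 2 * ρ / (1 + ρ) := by positivity
  have hs₁ : 2 * ρ / (1 + ρ) < 1 := by
    rw [div_lt_one (by positivity)]
    linarith
  refine ⟨⟨_, ResourceModel.isMicroFunction_cesMicro (one_div_pos.2 hs₀).le, fun p x hp hx =>
    ResourceModel.youngTransform_cesMicro hs₀ hs₁ (mul_nonneg hp hx)⟩, fun f hf hfs l hl => ?_⟩
  -- Taking x = (1, 1) yields the unit cost at every nonnegative price vector.
  have hfs' : ∀ q : Fin 2 → ℝ, 0 ≤ q → ResourceModel.youngTransform f q =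
      ResourceModel.cesUnitCost (2 * ρ / (1 + ρ)) q := fun q hq => by
    simpa using hfs q 1 hq zero_le_one
  by_cases hpos : ∀ j, 0 < l j
  · have h := ResourceModel.isGreatest_totalOutput hf hs₀ hfs'
      ResourceModel.ae_capacityMeasure_pos
      (fun p hp => ⟨ResourceModel.cesProfit_nonneg hγ₀ hγ₁ hα₁ hα₂ hp,
        ResourceModel.lintegral_profit hρ₀ hγ₀ hγ₁ hα₁ hα₂ hp⟩) hl
      (ResourceModel.cesPrice_pos hγ₀ hα₁ hα₂ hpos)
      (ResourceModel.hasDerivAt_cesProfit hρ₀ hγ₀ hγ₁ hα₁ hα₂ hpos)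
    rwa [ResourceModel.cesProfit_add_cost hρ₀ hγ₀ hγ₁ hα₁ hα₂ hpos] at h
  · obtain ⟨j, hj⟩ := not_forall.1 hpos
    have hF : ResourceModel.cesProduction α₁ α₂ ρ γ l = 0 :=
      if_neg fun h => hpos (Fin.forall_fin_two.2 h)
    simp only [hF, ENNReal.ofReal_zero]
    exact ResourceModel.isGreatest_totalOutput_zero hf hs₀ hfs'
      ResourceModel.ae_capacityMeasure_pos hl (le_antisymm (not_lt.1 hj) (hl j))
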